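/- Let $\Lambda=\{n_1X_1+n_2X_2 : n_1,n_2\in\mathbb{Z}\}$ be the period lattice generated by an arbitrary basis $X_1,X_2$ of $\mathbb{R}^2$, and let $M=\mathbb{R}^2/\Lambda$ be the corresponding flat torus with its Euclidean area measure. Let $H^1$ be the space of square integrable maps $\phi:M\to\mathbb{R}^3$ whose weak first partial derivatives $\phi_x,\phi_y$ are square integrable. For $k\in\mathbb{Z}$ let $$X_k=\{\phi\in H^1 : |\phi|=1\text{ almost everywhere},\ \deg(\phi)=k\},\qquad \deg(\phi)=\frac1{4\pi}\int_M\phi\cdot(\phi_x\times\phi_y).$$ Let $V:S^2\to\mathbb{R}$ be any function on the unit sphere $S^2\subset\mathbb{R}^3$ that admits a convex extension $\mathbb{R}^3\to\mathbb{R}$. Then for every $k\in\mathbb{Z}$ the baby Skyrme energy $$E:X_k\to(-\infty,\infty],\qquad E(\phi)=\int_M\left(\tfrac12|\phi_x|^2+\tfrac12|\phi_y|^2+\tfrac12|\phi_x\times\phi_y|^2+V(\phi)\right),$$ attains a minimum: there is $\phi\in X_k$ (in particular, $X_k$ is non-empty) such that $E(\phi)\le E(\psi)$ for all $\psi\in X_k$.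 -/

import Mathlib

open MeasureTheory
open scoped ContDiff ENNReal

noncomputable section

namespace BabySkyrme

/-- The Euclidean plane. -/
abbrev Plane : Type := EuclideanSpace ℝ (Fin 2)

/-- Euclidean three-space, the ambient space of the target sphere. -/
abbrev Space : Type := EuclideanSpace ℝ (Fin 3)

/-- The unit two-sphere. -/
abbrev Sphere : Type := Metric.sphere (0 : Space) 1

/-- The period lattice `{n₁ X₁ + n₂ X₂ : n₁, n₂ ∈ ℤ}` generated by a basis `X` of the plane. -/
def periodLattice (X : Module.Basis (Fin 2) ℝ Plane) : AddSubgroup Plane :=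
  (Submodule.span ℤ (Set.range X)).toAddSubgroup

/-- The torus, as the quotient of the plane by the period lattice. -/
abbrev Torus (X : Module.Basis (Fin 2) ℝ Plane) : Type := Plane ⧸ periodLattice X

/-- The quotient map from the plane to the torus. -/
def proj (X : Module.Basis (Fin 2) ℝ Plane) : Plane → Torus X := QuotientAddGroup.mk

/-- The Euclidean area measure of the torus: Lebesgue measure on a fundamental
parallelogram, transported to the quotient. -/
def area (X : Module.Basis (Fin 2) ℝ Plane) : Measure (Torus X) :=
  (volume.restrict (ZSpan.fundamentalDomain X)).map (proj X)

/-- A smooth real function on the torus: its lift to the plane is smooth. -/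
def IsSmooth {X : Module.Basis (Fin 2) ℝ Plane} (η : Torus X → ℝ) : Prop :=
  ContDiff ℝ ∞ (fun x : Plane => η (proj X x))

/-- The classical partial derivative of a function on the torus in the `i`-th Cartesian
direction, computed on the lift; the choice of the preimage of `q` is immaterial, see
`partialDeriv_proj`. -/
def partialDeriv {X : Module.Basis (Fin 2) ℝ Plane} (i : Fin 2) (η : Torus X → ℝ)
    (q : Torus X) : ℝ :=
  fderiv ℝ (fun x : Plane => η (proj X x)) (Quotient.out q) (EuclideanSpace.single i 1)

theorem partialDeriv_proj {X : Module.Basis (Fin 2) ℝ Plane} (i : Fin 2) (η : Torus X → ℝ)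
    (x : Plane) :
    partialDeriv i η (proj X x) =
      fderiv ℝ (fun y : Plane => η (proj X y)) x (EuclideanSpace.single i 1) := by
  have h1 : (QuotientAddGroup.mk (Quotient.out (proj X x)) : Torus X) =
      QuotientAddGroup.mk x := Quotient.out_eq (proj X x)
  rw [QuotientAddGroup.eq] at h1
  have h2 : (fun y : Plane => η (proj X (y + (-Quotient.out (proj X x) + x)))) =
      fun y : Plane => η (proj X y) := by
    funext y
    congr 1
    exact QuotientAddGroup.mk_add_of_mem y h1
  have h3 := fderiv_comp_add_right (𝕜 := ℝ) (f := fun y : Plane => η (proj X y))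
    (x := Quotient.out (proj X x)) (-Quotient.out (proj X x) + x)
  rw [h2, add_neg_cancel_left] at h3
  rw [partialDeriv, h3]

/-- The cross product of vectors in Euclidean three-space. -/
def cross (u v : Space) : Space := WithLp.toLp 2 (crossProduct (WithLp.ofLp u) (WithLp.ofLp v))

/-- `g` is the weak `i`-th partial derivative on the torus of the map `f`. -/
def HasWeakPartialDeriv {X : Module.Basis (Fin 2) ℝ Plane} (i : Fin 2)
    (f g : Torus X → Space) : Prop :=
  ∀ η : Torus X → ℝ, IsSmooth η →
    ∫ q, partialDeriv i η q • f q ∂(area X) = -∫ q, η q • g q ∂(area X)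

/-- A map in the Sobolev space `H¹` from the torus to three-space: a square integrable map
together with its two weak partial derivatives (which it determines almost everywhere), also
square integrable. -/
structure H1Map (X : Module.Basis (Fin 2) ℝ Plane) where
  /-- the map itself -/
  toFun : Torus X → Space
  /-- its weak partial derivatives: `d 0` in the direction `x`, `d 1` in the direction `y` -/
  d : Fin 2 → Torus X → Space
  memLp_toFun : MemLp toFun 2 (area X)
  memLp_d : ∀ i, MemLp (d i) 2 (area X)
  hasWeakPartialDeriv : ∀ i, HasWeakPartialDeriv i toFun (d i)

/-- The integral formula for the degree. For a map of class `H¹` with values almost everywhere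
in the unit sphere, the integrand is integrable. -/
def degree {X : Module.Basis (Fin 2) ℝ Plane} (φ : H1Map X) : ℝ :=
  1 / (4 * Real.pi) * ∫ q, inner ℝ (φ.toFun q) (cross (φ.d 0 q) (φ.d 1 q)) ∂(area X)

/-- The `H¹` maps from the torus to the unit sphere of degree `k`. -/
def degreeClass (X : Module.Basis (Fin 2) ℝ Plane) (k : ℤ) : Set (H1Map X) :=
  {φ | (∀ᵐ q ∂(area X), ‖φ.toFun q‖ = 1) ∧ degree φ = k}

/-- The function `V` admits a convex extension to the whole of three-space. -/
def HasConvexExtension (V : Sphere → ℝ) : Prop :=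
  ∃ F : Space → ℝ, ConvexOn ℝ Set.univ F ∧ ∀ p : Sphere, F p = V p

/-- The baby Skyrme energy
`∫ (½ |φ_x|² + ½ |φ_y|² + ½ |φ_x × φ_y|² + V(φ))`, with values in the extended reals. The
nonnegative terms, which may have infinite integral, are integrated in `[0, ∞]`; the potential
term is a bounded measurable function up to null sets when `V` is continuous and `φ` takes
values almost everywhere in the sphere. Off the sphere `V` is given the value zero, which then
only matters on a null set. -/
def energy {X : Module.Basis (Fin 2) ℝ Plane} (V : Sphere → ℝ) (φ : H1Map X) : EReal :=
  ((∫⁻ q, ENNReal.ofReal (1 / 2 * ‖φ.d 0 q‖ ^ 2 + 1 / 2 * ‖φ.d 1 q‖ ^ 2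
      + 1 / 2 * ‖cross (φ.d 0 q) (φ.d 1 q)‖ ^ 2) ∂(area X) : ℝ≥0∞) : EReal)
    + ((∫ q, Function.extend Subtype.val V (fun _ => 0) (φ.toFun q) ∂(area X) : ℝ) : EReal)

end BabySkyrme

end

/-! The proof is the direct method. The potential is bounded on sphere-valued maps, so a minimizing
sequence of finite energy has `φ_x`, `φ_y` and `J = φ_x × φ_y` bounded in `L²`. A subsequence has
weak `L²` limits of the maps, the derivatives and the Jacobians. Three things remain to be checked
(`exists_subseq_tendsto`).

The maps converge strongly in `L²`, by Rellich's theorem (`tendsto_zero_of_tendsto_inner`), hence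
almost everywhere along a further subsequence. So the limit takes values in the sphere, and the
potential term converges.

The weak limit of the Jacobians is the Jacobian of the limit (`jac_ae_eq_of_weakTendsto`). By
`integral_jacobian`, integrating a Jacobian against a smooth function gives terms with an
undifferentiated factor times one derivative; the first converges strongly and the second weakly, so
the product passes to the limit.

The degree is a multiple of the `L²` inner product of `φ` with `J`, again strong against weak, so it
is preserved. Weak lower semicontinuity of the norms then gives the minimum
(`exists_isMinOn_energy`).

Both analytic inputs are proved with Fourier series on the torus: weak derivatives act as
multipliers on coefficients, and an integrable function is determined by its coefficients.

Nonemptiness (`degreeClass_nonempty`) comes from an explicit `C¹` map: an arc from pole to pole is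
rotated `n` times about the axis, and a fixed arc closes up the curve without sweeping area. -/

noncomputable section

namespace BabySkyrme

open Filter Topology Complex

/-! ### Calculus and translation invariance on the torus. -/

section Torus

variable (X : Module.Basis (Fin 2) ℝ Plane)

instance : DiscreteTopology (periodLattice X) :=
  inferInstanceAs (DiscreteTopology (Submodule.span ℤ (Set.range X)).toAddSubgroup)

instance : IsClosed (periodLattice X : Set Plane) := AddSubgroup.isClosed_of_discrete

theorem continuous_proj : Continuous (proj X) := continuous_quot_mk

theorem proj_surjective : Function.Surjective (proj X) := QuotientAddGroup.mk_surjective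

theorem proj_add (x y : Plane) : proj X (x + y) = proj X x + proj X y := rfl

theorem proj_fract (x : Plane) : proj X (ZSpan.fract X x) = proj X x := by
  refine QuotientAddGroup.eq.2 ?_
  rw [ZSpan.fract_apply, neg_sub, sub_add_cancel]
  exact (ZSpan.floor X x).2

instance : CompactSpace (Torus X) := by
  have h : IsCompact (closure (ZSpan.fundamentalDomain X)) :=
    (ZSpan.fundamentalDomain_isBounded X).isCompact_closure
  refine ⟨?_⟩
  have h2 : (Set.univ : Set (Torus X)) = proj X '' closure (ZSpan.fundamentalDomain X) := by
    refine (Set.eq_univ_of_forall fun q => ?_).symm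
    obtain ⟨x, rfl⟩ := proj_surjective X q
    exact ⟨ZSpan.fract X x, subset_closure (ZSpan.fract_mem_fundamentalDomain X x), proj_fract X x⟩
  rw [h2]
  exact h.image (continuous_proj X)

instance : IsFiniteMeasure (area X) := by
  have : IsFiniteMeasure (volume.restrict (ZSpan.fundamentalDomain X)) :=
    ⟨by rw [Measure.restrict_apply_univ]
        exact (ZSpan.fundamentalDomain_isBounded X).measure_lt_top⟩
  exact Measure.isFiniteMeasure_map _ _

theorem area_univ_ne_zero : area X Set.univ ≠ 0 := by
  rw [area, Measure.map_apply (continuous_proj X).measurable MeasurableSet.univ, Set.preimage_univ,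
    Measure.restrict_apply_univ]
  exact ZSpan.measure_fundamentalDomain_ne_zero X

theorem area_real_univ_pos : 0 < (area X).real Set.univ :=
  ENNReal.toReal_pos (area_univ_ne_zero X) (measure_ne_top _ _)

/-- A translate of a fundamental domain is again a fundamental domain, and lattice-invariant sets
have the same measure in both. -/
theorem measurePreserving_add_area (h : Plane) :
    MeasurePreserving (fun q : Torus X => q + proj X h) (area X) (area X) := by
  have hm : Measurable fun q : Torus X => q + proj X h := (continuous_add_const _).measurable
  refine ⟨hm, ?_⟩
  have hp := (continuous_proj X).measurable
  have fd := ZSpan.isAddFundamentalDomain' X (volume : Measure Plane)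
  have fd2 := fd.vadd_of_comm h
  have : Countable (Submodule.span ℤ (Set.range X)).toAddSubgroup :=
    inferInstanceAs (Countable (Submodule.span ℤ (Set.range X)))
  ext s hs
  rw [Measure.map_apply hm hs, area, Measure.map_apply hp hs, Measure.map_apply hp (hm hs),
    Measure.restrict_apply (hp hs), Measure.restrict_apply (hp (hm hs)),
    fd.measure_set_eq fd2 (hp hs), ← measure_vadd volume h (proj X ⁻¹' _ ∩ _),
    Set.vadd_set_inter]
  · congr 2
    ext x
    rw [Set.mem_vadd_set_iff_neg_vadd_mem]
    simp only [Set.mem_preimage, vadd_eq_add, ← proj_add]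
    rw [neg_add_eq_sub, sub_add_cancel]
  · intro g
    ext x
    simp only [Set.mem_preimage]
    have : proj X (g +ᵥ x) = proj X x := by
      refine QuotientAddGroup.eq.2 ?_
      change -((g : Plane) + x) + x ∈ _
      rw [neg_add_rev, neg_add_cancel_comm]
      exact neg_mem g.2
    rw [this]

variable {X}
variable {E : Type*} [NormedAddCommGroup E] [NormedSpace ℝ E]

theorem integral_add_area (f : Torus X → E) (h : Plane) :
    ∫ q, f (q + proj X h) ∂(area X) = ∫ q, f q ∂(area X) :=
  (measurePreserving_add_area X h).integral_comp
    (Homeomorph.addRight (proj X h)).measurableEmbedding f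

/-- The partial derivative of a vector valued function on the torus. -/
def pderiv (i : Fin 2) (f : Torus X → E) (q : Torus X) : E :=
  fderiv ℝ (fun x : Plane => f (proj X x)) (Quotient.out q) (EuclideanSpace.single i 1)

theorem pderiv_proj (i : Fin 2) (f : Torus X → E) (x : Plane) :
    pderiv i f (proj X x) =
      fderiv ℝ (fun y : Plane => f (proj X y)) x (EuclideanSpace.single i 1) := by
  have h1 : (QuotientAddGroup.mk (Quotient.out (proj X x)) : Torus X) =
      QuotientAddGroup.mk x := Quotient.out_eq (proj X x)
  rw [QuotientAddGroup.eq] at h1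
  have h2 : (fun y : Plane => f (proj X (y + (-Quotient.out (proj X x) + x)))) =
      fun y : Plane => f (proj X y) := by
    funext y
    congr 1
    exact QuotientAddGroup.mk_add_of_mem y h1
  have h3 := fderiv_comp_add_right (𝕜 := ℝ) (f := fun y : Plane => f (proj X y))
    (x := Quotient.out (proj X x)) (-Quotient.out (proj X x) + x)
  rw [h2, add_neg_cancel_left] at h3
  rw [pderiv, h3]

theorem continuous_of_lift {F : Type*} [TopologicalSpace F] {f : Torus X → F}
    (hf : Continuous fun x => f (proj X x)) : Continuous f :=
  (QuotientAddGroup.isQuotientMap_mk (N := periodLattice X)).continuous_iff.2 hf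

theorem continuous_pderiv (i : Fin 2) {f : Torus X → E}
    (hf : ContDiff ℝ 1 fun x => f (proj X x)) : Continuous (pderiv i f) := by
  refine continuous_of_lift ?_
  simp only [pderiv_proj]
  exact (hf.continuous_fderiv one_ne_zero).clm_apply continuous_const

theorem exists_norm_le {F : Type*} [NormedAddCommGroup F] {f : Torus X → F}
    (hf : Continuous f) : ∃ C, ∀ q, ‖f q‖ ≤ C := by
  obtain ⟨C, hC⟩ := isCompact_univ.exists_bound_of_continuousOn hf.continuousOn
  exact ⟨C, fun q => hC q trivial⟩

theorem memLp_of_continuous {F : Type*} [NormedAddCommGroup F] {f : Torus X → F}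
    (hf : Continuous f) (p : ℝ≥0∞) :
    MemLp f p (area X) := by
  obtain ⟨C, hC⟩ := exists_norm_le hf
  exact MemLp.of_bound hf.aestronglyMeasurable_of_compactSpace C (Eventually.of_forall hC)

theorem integrable_of_continuous {F : Type*} [NormedAddCommGroup F] {f : Torus X → F}
    (hf : Continuous f) :
    Integrable f (area X) :=
  memLp_one_iff_integrable.1 (memLp_of_continuous hf 1)

theorem hasDerivAt_translate (i : Fin 2) {f : Torus X → E}
    (hf : ContDiff ℝ 1 fun x => f (proj X x)) (q : Torus X) (t : ℝ) :
    HasDerivAt (fun t : ℝ => f (q + proj X (t • EuclideanSpace.single i 1)))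
      (pderiv i f (q + proj X (t • EuclideanSpace.single i 1))) t := by
  obtain ⟨x, rfl⟩ := proj_surjective X q
  simp only [← proj_add, pderiv_proj]
  have h1 := (hf.differentiable one_ne_zero (x + t • EuclideanSpace.single i 1)).hasFDerivAt
  have h2 : HasDerivAt (fun t : ℝ => x + t • (EuclideanSpace.single i 1 : Plane))
      (EuclideanSpace.single i 1) t := by
    simpa using ((hasDerivAt_id t).smul_const (EuclideanSpace.single i 1 : Plane)).const_add x
  exact h1.comp_hasDerivAt t h2

/-- The integral of a translate of `f` does not depend on the translation; differentiating it at
zero under the integral sign gives the claim. All integration by parts below rests on this. -/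
theorem integral_pderiv_eq_zero (i : Fin 2) {f : Torus X → E}
    (hf : ContDiff ℝ 1 fun x => f (proj X x)) : ∫ q, pderiv i f q ∂(area X) = 0 := by
  have hc : Continuous f := continuous_of_lift hf.continuous
  have hd := continuous_pderiv i hf
  obtain ⟨C, hC⟩ := exists_norm_le hd
  have key := hasDerivAt_integral_of_dominated_loc_of_deriv_le (μ := area X)
    (F := fun (t : ℝ) q => f (q + proj X (t • EuclideanSpace.single i 1)))
    (F' := fun (t : ℝ) q => pderiv i f (q + proj X (t • EuclideanSpace.single i 1)))
    (x₀ := 0) (s := Set.univ) (bound := fun _ => C) univ_mem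
    (Eventually.of_forall fun t =>
      (hc.comp (continuous_add_const _)).aestronglyMeasurable_of_compactSpace)
    (integrable_of_continuous (hc.comp (continuous_add_const _)))
    (hd.comp (continuous_add_const (proj X ((0 : ℝ) • EuclideanSpace.single i 1)))
      ).aestronglyMeasurable_of_compactSpace
    (Eventually.of_forall fun q t _ => hC _) (integrable_const C)
    (Eventually.of_forall fun q t _ => hasDerivAt_translate i hf q t)
  have h2 := key.2
  simp only [integral_add_area] at h2
  exact h2.unique (hasDerivAt_const _ _)

theorem pderiv_smul (i : Fin 2) {η : Torus X → ℝ} {f : Torus X → E}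
    (hη : ContDiff ℝ 1 fun x => η (proj X x)) (hf : ContDiff ℝ 1 fun x => f (proj X x))
    (q : Torus X) :
    pderiv i (fun q => η q • f q) q = pderiv i η q • f q + η q • pderiv i f q := by
  obtain ⟨x, rfl⟩ := proj_surjective X q
  simp only [pderiv_proj]
  rw [fderiv_fun_smul (hη.differentiable one_ne_zero x) (hf.differentiable one_ne_zero x)]
  simp [add_comm]

theorem pderiv_mul (i : Fin 2) {η f : Torus X → ℂ}
    (hη : ContDiff ℝ 1 fun x => η (proj X x)) (hf : ContDiff ℝ 1 fun x => f (proj X x))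
    (q : Torus X) :
    pderiv i (fun q => η q * f q) q = pderiv i η q * f q + η q * pderiv i f q := by
  obtain ⟨x, rfl⟩ := proj_surjective X q
  simp only [pderiv_proj]
  rw [fderiv_fun_mul (hη.differentiable one_ne_zero x) (hf.differentiable one_ne_zero x)]
  simp [mul_comm, add_comm]

end Torus

/-! ### Characters of the torus and the symbol of the Laplacian. -/

section Characters

variable (X : Module.Basis (Fin 2) ℝ Plane)

/-- The linear form on the plane whose values at the basis vectors are the integers `m`. -/
def phase (m : Fin 2 → ℤ) : Plane →L[ℝ] ℝ :=
  LinearMap.toContinuousLinearMap ((m 0 : ℝ) • X.coord 0 + (m 1 : ℝ) • X.coord 1)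

theorem phase_apply (m : Fin 2 → ℤ) (x : Plane) :
    phase X m x = m 0 * X.repr x 0 + m 1 * X.repr x 1 := by
  simp [phase]

theorem phase_add (m n : Fin 2 → ℤ) (x : Plane) :
    phase X (m + n) x = phase X m x + phase X n x := by
  simp only [phase_apply, Pi.add_apply, Int.cast_add]; ring

theorem phase_neg (m : Fin 2 → ℤ) (x : Plane) : phase X (-m) x = -phase X m x := by
  simp only [phase_apply, Pi.neg_apply, Int.cast_neg]; ring

theorem phase_basis (m : Fin 2 → ℤ) (j : Fin 2) : phase X m (X j) = m j := by
  fin_cases j <;> simp [phase_apply]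

theorem exists_phase_eq_int (m : Fin 2 → ℤ) {x : Plane} (hx : x ∈ periodLattice X) :
    ∃ n : ℤ, phase X m x = n := by
  have h := (X.mem_span_iff_repr_mem ℤ x).1 hx
  obtain ⟨a, ha⟩ := h 0
  obtain ⟨b, hb⟩ := h 1
  refine ⟨m 0 * a + m 1 * b, ?_⟩
  rw [phase_apply, ← ha, ← hb]
  simp

/-- The characters of the torus. -/
def chi (m : Fin 2 → ℤ) : Torus X → ℂ :=
  Quotient.lift (fun x : Plane => cexp (2 * Real.pi * I * phase X m x)) (by
    intro x y hxy
    have h : -x + y ∈ periodLattice X := QuotientAddGroup.leftRel_apply.1 hxy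
    obtain ⟨n, hn⟩ := exists_phase_eq_int X m h
    have : phase X m y = phase X m x + n := by
      rw [← hn, map_add, map_neg]; ring
    refine Complex.exp_eq_exp_iff_exists_int.2 ⟨-n, ?_⟩
    rw [this]; push_cast; ring)

theorem chi_proj (m : Fin 2 → ℤ) (x : Plane) :
    chi X m (proj X x) = cexp (2 * Real.pi * I * phase X m x) := rfl

theorem contDiff_chi (m : Fin 2 → ℤ) {n : WithTop ℕ∞} :
    ContDiff ℝ n fun x => chi X m (proj X x) := by
  simp only [chi_proj]
  exact (contDiff_const.mul (Complex.ofRealCLM.contDiff.comp (phase X m).contDiff)).cexp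

theorem continuous_chi (m : Fin 2 → ℤ) : Continuous (chi X m) :=
  continuous_of_lift (contDiff_chi X m (n := 0)).continuous

theorem pderiv_chi (i : Fin 2) (m : Fin 2 → ℤ) (q : Torus X) :
    pderiv i (chi X m) q =
      2 * Real.pi * I * phase X m (EuclideanSpace.single i 1) * chi X m q := by
  obtain ⟨x, rfl⟩ := proj_surjective X q
  rw [pderiv_proj]
  simp only [chi_proj]
  have h : HasFDerivAt (fun x => 2 * Real.pi * I * (phase X m x : ℂ))
      ((2 * Real.pi * I) • (Complex.ofRealCLM.comp (phase X m))) x :=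
    (Complex.ofRealCLM.comp (phase X m)).hasFDerivAt.const_mul _
  rw [h.cexp.fderiv]
  simp
  ring

theorem chi_neg (m : Fin 2 → ℤ) (q : Torus X) : chi X (-m) q = starRingEnd ℂ (chi X m q) := by
  obtain ⟨x, rfl⟩ := proj_surjective X q
  rw [chi_proj, chi_proj, phase_neg, ← Complex.exp_conj]
  simp [Complex.conj_ofNat]

theorem chi_add (m n : Fin 2 → ℤ) (q : Torus X) : chi X (m + n) q = chi X m q * chi X n q := by
  obtain ⟨x, rfl⟩ := proj_surjective X q
  rw [chi_proj, chi_proj, chi_proj, phase_add, ← Complex.exp_add]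
  push_cast; ring_nf

theorem chi_zero (q : Torus X) : chi X 0 q = 1 := by
  obtain ⟨x, rfl⟩ := proj_surjective X q
  simp [chi_proj, phase_apply]

theorem norm_chi (m : Fin 2 → ℤ) (q : Torus X) : ‖chi X m q‖ = 1 := by
  obtain ⟨x, rfl⟩ := proj_surjective X q
  rw [chi_proj, show 2 * Real.pi * I * (phase X m x : ℂ) = ((2 * Real.pi * phase X m x : ℝ) : ℂ) * I
    by push_cast; ring]
  exact Complex.norm_exp_ofReal_mul_I _

/-- The linear form `phase X m` is determined by its values in the Cartesian directions. -/
theorem coe_eq_sum_phase (m : Fin 2 → ℤ) (j : Fin 2) :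
    (m j : ℝ) = ∑ i, X j i * phase X m (EuclideanSpace.single i 1) := by
  rw [← phase_basis X m j]
  conv_lhs => rw [← (EuclideanSpace.basisFun (Fin 2) ℝ).sum_repr (X j)]
  simp

/-- The derivatives of a character are multiples of it and integrate to zero. A nonzero integral
would force the phase to vanish in both Cartesian directions, hence `m = 0`. -/
theorem integral_chi {m : Fin 2 → ℤ} (hm : m ≠ 0) : ∫ q, chi X m q ∂(area X) = 0 := by
  by_contra h
  refine hm (funext fun j => ?_)
  have h0 : ∀ i : Fin 2, phase X m (EuclideanSpace.single i 1) = 0 := by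
    intro i
    have := integral_pderiv_eq_zero i (contDiff_chi X m)
    simp only [pderiv_chi] at this
    rw [integral_const_mul] at this
    simpa [h, Real.pi_ne_zero] using this
  have := coe_eq_sum_phase X m j
  simpa [h0] using this

/-- The symbol of minus the Laplacian. -/
def symbol (m : Fin 2 → ℤ) : ℝ :=
  ∑ i, (2 * Real.pi * phase X m (EuclideanSpace.single i 1)) ^ 2

/-- The source of compactness in Rellich's theorem. Each `m j` is a fixed linear combination of the
Cartesian frequencies, which the symbol bounds by `√R`. -/
theorem finite_symbol_le (R : ℝ) : {m : Fin 2 → ℤ | symbol X m ≤ R}.Finite := by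
  obtain ⟨C, hC⟩ : ∃ C : ℝ, ∀ j i : Fin 2, |X j i| ≤ C :=
    ⟨∑ j, ∑ i, |X j i|, fun j i =>
      (Finset.single_le_sum (f := fun i => |X j i|) (fun _ _ => abs_nonneg _)
        (Finset.mem_univ i)).trans
      (Finset.single_le_sum (f := fun j => ∑ i, |X j i|)
        (fun _ _ => Finset.sum_nonneg fun _ _ => abs_nonneg _) (Finset.mem_univ j))⟩
  have hbound : ∀ m ∈ {m : Fin 2 → ℤ | symbol X m ≤ R}, ∀ j, |(m j : ℝ)| ≤ C * √R + C * √R := by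
    intro m hm j
    have h1 : ∀ i, |phase X m (EuclideanSpace.single i 1)| ≤ √R := by
      intro i
      refine Real.abs_le_sqrt (le_trans ?_ hm)
      refine le_trans ?_ (Finset.single_le_sum
        (f := fun i => (2 * Real.pi * phase X m (EuclideanSpace.single i 1)) ^ 2)
        (fun _ _ => sq_nonneg _) (Finset.mem_univ i))
      have : (1 : ℝ) ≤ (2 * Real.pi) ^ 2 := by nlinarith [Real.pi_gt_three]
      nlinarith [sq_nonneg (phase X m (EuclideanSpace.single i 1))]
    rw [coe_eq_sum_phase X m j, Fin.sum_univ_two]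
    refine (abs_add_le _ _).trans ?_
    rw [abs_mul, abs_mul]
    have hC0 : 0 ≤ C := (abs_nonneg _).trans (hC 0 0)
    exact add_le_add (mul_le_mul (hC j 0) (h1 0) (abs_nonneg _) hC0)
      (mul_le_mul (hC j 1) (h1 1) (abs_nonneg _) hC0)
  obtain ⟨N, hN⟩ := exists_nat_ge (C * √R + C * √R)
  refine (Set.finite_Icc (fun _ : Fin 2 => -(N : ℤ)) (fun _ => (N : ℤ))).subset fun m hm => ?_
  have h2 : ∀ j, |m j| ≤ (N : ℤ) := fun j => by
    have := (hbound m hm j).trans hN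
    exact_mod_cast this
  exact ⟨fun j => (abs_le.1 (h2 j)).1, fun j => (abs_le.1 (h2 j)).2⟩

end Characters

/-! ### Completeness of the characters in `C`, `L²` and `L¹`. -/

section Fourier

variable (X : Module.Basis (Fin 2) ℝ Plane)

/-- The characters of the torus, as continuous functions. -/
def chiC (m : Fin 2 → ℤ) : C(Torus X, ℂ) := ⟨chi X m, continuous_chi X m⟩

theorem chiC_apply (m : Fin 2 → ℤ) (q : Torus X) : chiC X m q = chi X m q := rfl

/-- The star subalgebra generated by the characters. -/
def chiSubalgebra : StarSubalgebra ℂ C(Torus X, ℂ) where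
  toSubalgebra := Algebra.adjoin ℂ (Set.range (chiC X))
  star_mem' := by
    change Algebra.adjoin ℂ (Set.range (chiC X)) ≤ star (Algebra.adjoin ℂ (Set.range (chiC X)))
    refine Algebra.adjoin_le ?_
    rintro _ ⟨n, rfl⟩
    refine Algebra.subset_adjoin ⟨-n, ?_⟩
    ext1 q
    exact chi_neg X n q

theorem chiSubalgebra_coe :
    (chiSubalgebra X).toSubalgebra.toSubmodule = Submodule.span ℂ (Set.range (chiC X)) := by
  apply Algebra.adjoin_eq_span_of_subset
  refine .trans (fun x ↦ Submonoid.closure_induction (fun _ ↦ id) ⟨0, ?_⟩ ?_) Submodule.subset_span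
  · ext q
    exact chi_zero X q
  · rintro _ _ _ _ ⟨m, rfl⟩ ⟨n, rfl⟩
    refine ⟨m + n, ?_⟩
    ext q
    exact chi_add X m n q

/-- The character of frequency `Pi.single j 1` determines the `j`-th coordinate modulo the integers.
-/
theorem chiSubalgebra_separatesPoints : (chiSubalgebra X).SeparatesPoints := by
  intro p q hpq
  by_contra! hcon
  have h : ∀ m, chi X m p = chi X m q := fun m =>
    hcon _ ⟨chiC X m, Algebra.subset_adjoin ⟨m, rfl⟩, rfl⟩
  obtain ⟨x, rfl⟩ := proj_surjective X p
  obtain ⟨y, rfl⟩ := proj_surjective X q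
  refine hpq (QuotientAddGroup.eq.2 ((X.mem_span_iff_repr_mem ℤ _).2 fun j => ?_))
  obtain ⟨n, hn⟩ := Complex.exp_eq_exp_iff_exists_int.1 (h (Pi.single j 1))
  have hphase : ∀ z, phase X (Pi.single j 1) z = X.repr z j := by
    intro z
    rw [phase_apply]
    fin_cases j <;> simp
  rw [hphase, hphase] at hn
  have h2 : (2 * Real.pi * I : ℂ) ≠ 0 := Complex.two_pi_I_ne_zero
  have h3 : ((X.repr x j : ℝ) : ℂ) = X.repr y j + n := by
    apply mul_left_cancel₀ h2
    rw [hn]; ring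
  have h4 : X.repr x j = X.repr y j + n := by exact_mod_cast h3
  refine ⟨-n, ?_⟩
  simp [h4]

theorem span_chiC_closure_eq_top :
    (Submodule.span ℂ (Set.range (chiC X))).topologicalClosure = ⊤ := by
  rw [← chiSubalgebra_coe]
  exact congr_arg (Subalgebra.toSubmodule <| StarSubalgebra.toSubalgebra ·)
    (ContinuousMap.starSubalgebra_topologicalClosure_eq_top_of_separatesPoints _
      (chiSubalgebra_separatesPoints X))

/-- The characters, normalized in `L²`. -/
def chiLp (m : Fin 2 → ℤ) : Lp ℂ 2 (area X) :=
  (((√((area X).real Set.univ))⁻¹ : ℝ) : ℂ) • ContinuousMap.toLp (E := ℂ) 2 (area X) ℂ (chiC X m)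

theorem inner_chiLp (m : Fin 2 → ℤ) (f : Lp ℂ 2 (area X)) :
    inner ℂ (chiLp X m) f =
      (((√((area X).real Set.univ))⁻¹ : ℝ) : ℂ) * ∫ q, chi X (-m) q * f q ∂(area X) := by
  rw [chiLp, inner_smul_left, conj_ofReal, L2.inner_def]
  congr 1
  refine integral_congr_ae ?_
  filter_upwards [ContinuousMap.coeFn_toLp (p := 2) (𝕜 := ℂ) (area X) (chiC X m)] with q hq
  rw [hq, RCLike.inner_apply, chi_neg, mul_comm, chiC_apply]

theorem orthonormal_chiLp : Orthonormal ℂ (chiLp X) := by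
  have hA := area_real_univ_pos X
  rw [orthonormal_iff_ite]
  intro m n
  rw [chiLp, chiLp, inner_smul_left, inner_smul_right, ContinuousMap.inner_toLp]
  simp only [chiC_apply, ← chi_neg, ← chi_add]
  split_ifs with h
  · simp only [h, add_neg_cancel, chi_zero, integral_const, conj_ofReal]
    rw [← mul_assoc, ← ofReal_mul, ← mul_inv, Real.mul_self_sqrt hA.le]
    simp only [real_smul, mul_one]
    rw [← ofReal_mul, inv_mul_cancel₀ hA.ne', ofReal_one]
  · rw [integral_chi, mul_zero, mul_zero]
    rwa [← sub_eq_add_neg, sub_ne_zero, ne_comm]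

theorem span_chiLp_closure_eq_top :
    (Submodule.span ℂ (Set.range (chiLp X))).topologicalClosure = ⊤ := by
  have h1 := (ContinuousMap.toLp_denseRange (p := 2) ℂ (area X) ℂ
    (by norm_num)).topologicalClosure_map_submodule (span_chiC_closure_eq_top X)
  rw [← top_le_iff, ← h1]
  refine Submodule.topologicalClosure_mono ?_
  rw [Submodule.map_span, Submodule.span_le]
  rintro _ ⟨_, ⟨m, rfl⟩, rfl⟩
  have hc : (((√((area X).real Set.univ))⁻¹ : ℝ) : ℂ) ≠ 0 :=
    ofReal_ne_zero.2 (inv_ne_zero (Real.sqrt_ne_zero'.2 (area_real_univ_pos X)))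
  have : ContinuousMap.toLp (E := ℂ) 2 (area X) ℂ (chiC X m) =
      (((√((area X).real Set.univ))⁻¹ : ℝ) : ℂ)⁻¹ • chiLp X m := by
    rw [chiLp, inv_smul_smul₀ hc]
  simp only [SetLike.mem_coe]
  erw [this]
  exact Submodule.smul_mem _ _ (Submodule.subset_span ⟨m, rfl⟩)

/-- The Hilbert basis of normalized characters. -/
def chiBasis : HilbertBasis (Fin 2 → ℤ) ℂ (Lp ℂ 2 (area X)) :=
  HilbertBasis.mk (orthonormal_chiLp X) (span_chiLp_closure_eq_top X).ge

theorem coe_chiBasis : ⇑(chiBasis X) = chiLp X := HilbertBasis.coe_mk _ _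

variable {X}

/-- Integration against `h` is sup-norm continuous on `C(Torus X, ℂ)` and vanishes on the dense span
of the characters. Only integrability of `h` is available where this is needed, so the `L²` Hilbert
basis would not do. -/
theorem integral_continuous_mul_eq_zero {h : Torus X → ℂ} (hh : Integrable h (area X))
    (hz : ∀ m, ∫ q, chi X m q * h q ∂(area X) = 0) (f : C(Torus X, ℂ)) :
    ∫ q, f q * h q ∂(area X) = 0 := by
  have hint : ∀ f : C(Torus X, ℂ), Integrable (fun q => f q * h q) (area X) := fun f =>
    hh.bdd_mul f.continuous.aestronglyMeasurable_of_compactSpace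
      (Eventually.of_forall fun q => f.norm_coe_le_norm q)
  let L : C(Torus X, ℂ) →ₗ[ℂ] ℂ :=
    { toFun := fun f => ∫ q, f q * h q ∂(area X)
      map_add' := fun f g => by
        rw [← integral_add (hint f) (hint g)]
        simp only [ContinuousMap.add_apply, add_mul]
      map_smul' := fun c f => by
        rw [RingHom.id_apply, smul_eq_mul, ← integral_const_mul]
        simp only [ContinuousMap.smul_apply, smul_eq_mul, mul_assoc] }
  let L' : C(Torus X, ℂ) →L[ℂ] ℂ := L.mkContinuous (∫ q, ‖h q‖ ∂(area X)) fun f => by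
    change ‖∫ q, f q * h q ∂(area X)‖ ≤ _
    refine (norm_integral_le_integral_norm _).trans ?_
    rw [mul_comm, ← integral_const_mul]
    refine integral_mono (hint f).norm (hh.norm.const_mul _) fun q => ?_
    simp only [norm_mul]
    exact mul_le_mul_of_nonneg_right (f.norm_coe_le_norm q) (norm_nonneg _)
  have hle : Submodule.span ℂ (Set.range (chiC X)) ≤
      LinearMap.ker (L' : C(Torus X, ℂ) →ₗ[ℂ] ℂ) := by
    rw [Submodule.span_le]
    rintro _ ⟨m, rfl⟩
    exact hz m
  have htop := Submodule.topologicalClosure_minimal _ hle L'.isClosed_ker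
  rw [span_chiC_closure_eq_top] at htop
  exact htop (Submodule.mem_top : f ∈ ⊤)

/-- An integrable function all of whose Fourier coefficients vanish is zero. -/
theorem ae_eq_zero_of_integral_chi_mul_eq_zero {h : Torus X → ℂ} (hh : Integrable h (area X))
    (hz : ∀ m, ∫ q, chi X m q * h q ∂(area X) = 0) : h =ᵐ[area X] 0 := by
  refine ae_eq_zero_of_forall_setIntegral_isClosed_eq_zero hh fun K hK => ?_
  -- The indicator of a closed set is a pointwise limit of continuous functions bounded by one, so
  -- dominated convergence reduces to continuous test functions.
  have hlim : Tendsto (fun n : ℕ => ∫ q, ((thickenedIndicator (δ := 1 / ((n : ℝ) + 1))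
      Nat.one_div_pos_of_nat K q : ℝ) : ℂ) * h q ∂(area X)) atTop
      (𝓝 (∫ q, K.indicator (fun _ => (1 : ℂ)) q * h q ∂(area X))) := by
    refine tendsto_integral_of_dominated_convergence (fun q => ‖h q‖) (fun n => ?_) hh.norm
      (fun n => Eventually.of_forall fun q => ?_) (Eventually.of_forall fun q => ?_)
    · refine AEStronglyMeasurable.mul (Continuous.aestronglyMeasurable_of_compactSpace ?_) hh.1
      fun_prop
    · rw [norm_mul, Complex.norm_real, Real.norm_of_nonneg NNReal.zero_le_coe]
      exact mul_le_of_le_one_left (norm_nonneg _) (thickenedIndicator_le_one _ _ _)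
    · refine Tendsto.mul_const _ ?_
      have h1 := thickenedIndicator_tendsto_indicator_closure
        (δseq := fun n : ℕ => 1 / ((n : ℝ) + 1)) (fun _ => Nat.one_div_pos_of_nat)
        tendsto_one_div_add_atTop_nhds_zero_nat K
      rw [tendsto_pi_nhds] at h1
      have h2 := h1 q
      rw [hK.closure_eq] at h2
      have h3 := (Complex.continuous_ofReal.comp NNReal.continuous_coe).continuousAt.tendsto.comp h2
      have h4 : K.indicator (fun _ => (1 : ℂ)) q =
          (ofReal ∘ NNReal.toReal) (K.indicator (fun _ => 1) q) := by
        by_cases hq : q ∈ K <;> simp [hq]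
      rw [h4]
      exact h3
  have hzero : ∀ n : ℕ, ∫ q, ((thickenedIndicator (δ := 1 / ((n : ℝ) + 1))
      Nat.one_div_pos_of_nat K q : ℝ) : ℂ) * h q ∂(area X) = 0 := fun n =>
    integral_continuous_mul_eq_zero hh hz ⟨fun q => ((thickenedIndicator (δ := 1 / ((n : ℝ) + 1))
      Nat.one_div_pos_of_nat K q : ℝ) : ℂ), by fun_prop⟩
  simp only [hzero] at hlim
  rw [← integral_indicator hK.measurableSet]
  refine Eq.trans ?_ (tendsto_nhds_unique tendsto_const_nhds hlim).symm
  refine integral_congr_ae (Eventually.of_forall fun q => ?_)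
  by_cases hq : q ∈ K <;> simp [Set.indicator, hq]

end Fourier

/-! ### Weak derivatives, Rellich's theorem and the weak Jacobian identity. -/

section WeakDerivatives

variable {X : Module.Basis (Fin 2) ℝ Plane}

/-- `g` is the weak `i`-th partial derivative of the complex valued function `u`. -/
def IsWeakDeriv (i : Fin 2) (u g : Torus X → ℂ) : Prop :=
  ∀ η : Torus X → ℂ, (ContDiff ℝ ∞ fun x => η (proj X x)) →
    ∫ q, pderiv i η q * u q ∂(area X) = -∫ q, η q * g q ∂(area X)

theorem memLp_mul_of_continuous {a f : Torus X → ℂ} (ha : Continuous a)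
    (hf : MemLp f 2 (area X)) : MemLp (fun q => a q * f q) 2 (area X) := by
  obtain ⟨C, hC⟩ := exists_norm_le ha
  exact MemLp.of_le_mul hf (ha.aestronglyMeasurable_of_compactSpace.mul hf.1) (c := C)
    (Eventually.of_forall fun q => by
      rw [norm_mul]; exact mul_le_mul_of_nonneg_right (hC q) (norm_nonneg _))

theorem integrable_mul_of_continuous {a f : Torus X → ℂ} (ha : Continuous a)
    (hf : MemLp f 2 (area X)) : Integrable (fun q => a q * f q) (area X) :=
  (memLp_mul_of_continuous ha hf).integrable one_le_two

/-- The linear form `f ↦ ∫ a f` on `L²`. -/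
def pairing {a : Torus X → ℂ} (ha : MemLp a 2 (area X)) : Lp ℂ 2 (area X) →L[ℂ] ℂ :=
  innerSL ℂ (ha.star.toLp (star a))

theorem pairing_apply {a : Torus X → ℂ} (ha : MemLp a 2 (area X)) (f : Lp ℂ 2 (area X)) :
    pairing ha f = ∫ q, a q * f q ∂(area X) := by
  rw [pairing, innerSL_apply_apply, L2.inner_def]
  refine integral_congr_ae ?_
  filter_upwards [ha.star.coeFn_toLp] with q hq
  rw [hq, RCLike.inner_apply, Pi.star_apply]
  simp [mul_comm]

theorem pairing_chiLp {a : Torus X → ℂ} (ha : MemLp a 2 (area X)) (m : Fin 2 → ℤ) :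
    pairing ha (chiLp X m) =
      (((√((area X).real Set.univ))⁻¹ : ℝ) : ℂ) * ∫ q, a q * chi X m q ∂(area X) := by
  rw [chiLp, map_smul, pairing_apply, smul_eq_mul]
  congr 1
  refine integral_congr_ae ?_
  filter_upwards [ContinuousMap.coeFn_toLp (p := 2) (𝕜 := ℂ) (area X) (chiC X m)] with q hq
  rw [hq, chiC_apply]

/-- Testing with the conjugate character `chi X (-m)` turns weak differentiation into multiplication
of Fourier coefficients. -/
theorem IsWeakDeriv.inner_chiLp {i : Fin 2} {u g : Lp ℂ 2 (area X)} (h : IsWeakDeriv i u g)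
    (m : Fin 2 → ℤ) :
    inner ℂ (chiLp X m) g =
      2 * Real.pi * I * phase X m (EuclideanSpace.single i 1) * inner ℂ (chiLp X m) u := by
  have h1 := h (chi X (-m)) (contDiff_chi X _)
  simp only [pderiv_chi, mul_assoc] at h1
  simp only [integral_const_mul, phase_neg, ofReal_neg] at h1
  rw [BabySkyrme.inner_chiLp, BabySkyrme.inner_chiLp]
  linear_combination (((√((area X).real Set.univ))⁻¹ : ℝ) : ℂ) * h1

theorem symbol_mul_norm_sq_inner {u : Lp ℂ 2 (area X)} {g : Fin 2 → Lp ℂ 2 (area X)}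
    (h : ∀ i, IsWeakDeriv i u (g i)) (m : Fin 2 → ℤ) :
    symbol X m * ‖inner ℂ (chiLp X m) u‖ ^ 2 = ∑ i, ‖inner ℂ (chiLp X m) (g i)‖ ^ 2 := by
  rw [symbol, Finset.sum_mul]
  refine Finset.sum_congr rfl fun i _ => ?_
  rw [(h i).inner_chiLp, norm_mul, mul_pow ‖_‖]
  congr 1
  simp [mul_pow]

theorem hasSum_norm_sq_inner (u : Lp ℂ 2 (area X)) :
    HasSum (fun m => ‖inner ℂ (chiLp X m) u‖ ^ 2) (‖u‖ ^ 2) := by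
  have h := (chiBasis X).hasSum_inner_mul_inner u u
  rw [coe_chiBasis] at h
  have h2 := Complex.reCLM.hasSum h
  convert h2 using 1
  · funext m
    rw [← inner_conj_symm u, Complex.reCLM_apply, mul_comm, Complex.mul_conj,
      Complex.ofReal_re, Complex.normSq_eq_norm_sq]
  · rw [inner_self_eq_norm_sq_to_K, Complex.reCLM_apply]
    norm_cast

/-- The Rellich compactness theorem: a bounded sequence in `H¹` that converges weakly to zero
in `L²` converges strongly to zero in `L²`. -/
theorem tendsto_zero_of_tendsto_inner {u : ℕ → Lp ℂ 2 (area X)}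
    {g : Fin 2 → ℕ → Lp ℂ 2 (area X)} (h : ∀ i n, IsWeakDeriv i (u n) (g i n)) {K : ℝ}
    (hK : ∀ i n, ‖g i n‖ ≤ K)
    (h0 : ∀ m, Tendsto (fun n => inner ℂ (chiLp X m) (u n)) atTop (𝓝 0)) :
    Tendsto u atTop (𝓝 0) := by
  -- Split Parseval's sum at symbol `R`. There are finitely many low modes; on a high mode `1 ≤ R⁻¹
  -- * symbol`, so the tail is at most `R⁻¹` times the squared norms of the two derivatives.
  have hest : ∀ R : ℝ, 0 < R → ∀ n, ‖u n‖ ^ 2 ≤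
      (∑ m ∈ (finite_symbol_le X R).toFinset, ‖inner ℂ (chiLp X m) (u n)‖ ^ 2)
        + R⁻¹ * (2 * K ^ 2) := by
    intro R hR n
    have h1 := hasSum_norm_sq_inner (u n)
    have h2 : HasSum (fun m => ∑ i, ‖inner ℂ (chiLp X m) (g i n)‖ ^ 2) (∑ i, ‖g i n‖ ^ 2) :=
      hasSum_sum fun i _ => hasSum_norm_sq_inner (g i n)
    have h3 := hasSum_sum_of_ne_finset_zero
      (L := SummationFilter.unconditional _) (s := (finite_symbol_le X R).toFinset)
      (f := fun m => if symbol X m ≤ R then ‖inner ℂ (chiLp X m) (u n)‖ ^ 2 else 0) (by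
        intro m hm
        exact if_neg (by simpa using hm))
    have h4 := hasSum_le (fun m => ?_) h1 (h3.add (h2.mul_left R⁻¹))
    · refine h4.trans (add_le_add (le_of_eq (Finset.sum_congr rfl fun m hm => ?_))
        (mul_le_mul_of_nonneg_left ?_ (inv_nonneg.2 hR.le)))
      · exact if_pos (by simpa using hm)
      · rw [Fin.sum_univ_two, two_mul]
        exact add_le_add (pow_le_pow_left₀ (norm_nonneg _) (hK 0 n) 2)
          (pow_le_pow_left₀ (norm_nonneg _) (hK 1 n) 2)
    · rw [← symbol_mul_norm_sq_inner (fun i => h i n)]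
      split_ifs with hm
      · have : 0 ≤ symbol X m := Finset.sum_nonneg fun _ _ => sq_nonneg _
        have : 0 ≤ R⁻¹ * (symbol X m * ‖inner ℂ (chiLp X m) (u n)‖ ^ 2) := by positivity
        linarith
      · rw [zero_add, ← mul_assoc]
        refine le_mul_of_one_le_left (sq_nonneg _) ?_
        rw [← inv_mul_cancel₀ hR.ne']
        exact mul_le_mul_of_nonneg_left (not_le.1 hm).le (inv_nonneg.2 hR.le)
  rw [tendsto_zero_iff_norm_tendsto_zero]
  have hsq : Tendsto (fun n => ‖u n‖ ^ 2) atTop (𝓝 0) := by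
    rw [Metric.tendsto_atTop]
    intro ε hε
    obtain ⟨R, hR, hRε⟩ : ∃ R : ℝ, 0 < R ∧ R⁻¹ * (2 * K ^ 2) < ε / 2 := by
      -- The summand `1` makes the inequality strict and keeps `R` positive when `K = 0`.
      refine ⟨(2 * K ^ 2 + 1) / (ε / 2), by positivity, ?_⟩
      rw [inv_div, div_mul_eq_mul_div, div_lt_iff₀ (by positivity)]
      nlinarith
    have hfin : Tendsto (fun n => ∑ m ∈ (finite_symbol_le X R).toFinset,
        ‖inner ℂ (chiLp X m) (u n)‖ ^ 2) atTop (𝓝 0) := by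
      have := tendsto_finsetSum (finite_symbol_le X R).toFinset
        (fun m _ => ((h0 m).norm.pow 2))
      simpa using this
    obtain ⟨N, hN⟩ := (Metric.tendsto_atTop.1 hfin) (ε / 2) (by positivity)
    refine ⟨N, fun n hn => ?_⟩
    have h5 := hN n hn
    rw [Real.dist_eq, sub_zero] at h5 ⊢
    rw [abs_of_nonneg (sq_nonneg _)]
    linarith [hest R hR n, le_abs_self (∑ m ∈ (finite_symbol_le X R).toFinset,
        ‖inner ℂ (chiLp X m) (u n)‖ ^ 2)]
  have := hsq.sqrt
  simpa using this

/-- The weak form of the Jacobian determinant of two functions of class `H¹`. -/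
theorem integral_jacobian {u v : Lp ℂ 2 (area X)} {du dv : Fin 2 → Lp ℂ 2 (area X)}
    (hu : ∀ i, IsWeakDeriv i u (du i)) (hv : ∀ i, IsWeakDeriv i v (dv i)) {η : Torus X → ℂ}
    (hη : ContDiff ℝ ∞ fun x => η (proj X x)) :
    ∫ q, η q * (du 0 q * dv 1 q - du 1 q * dv 0 q) ∂(area X) =
      ∫ q, (pderiv 1 η q * u q) * dv 0 q ∂(area X)
        - ∫ q, (pderiv 0 η q * u q) * dv 1 q ∂(area X) := by
  have hη1 : ContDiff ℝ 1 fun x => η (proj X x) := hη.of_le (by simp)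
  have hcη : Continuous η := continuous_of_lift hη.continuous
  have hA : ∀ i, MemLp (fun q => η q * du i q) 2 (area X) := fun i =>
    memLp_mul_of_continuous hcη (Lp.memLp _)
  have hB : ∀ i, MemLp (fun q => pderiv i η q * u q) 2 (area X) := fun i =>
    memLp_mul_of_continuous (continuous_pderiv i hη1) (Lp.memLp _)
  -- `L i` is integration against the product-rule expression for the `i`-th derivative of `η u`.
  -- The identity sought amounts to `L 0 (dv 1) = L 1 (dv 0)`, that is, to the symmetry of second
  -- derivatives.
  let L : Fin 2 → Lp ℂ 2 (area X) →L[ℂ] ℂ := fun i => pairing (hA i) + pairing (hB i)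
  have hchi : ∀ i m, L i (chiLp X m) = -(2 * Real.pi * I * phase X m (EuclideanSpace.single i 1) *
      ((((√((area X).real Set.univ))⁻¹ : ℝ) : ℂ) * ∫ q, η q * chi X m q * u q ∂(area X))) := by
    intro i m
    have h1 := hu i (fun q => η q * chi X m q) (hη.mul (contDiff_chi X m))
    have hc2 : Continuous fun q => η q * chi X m q := hcη.mul (continuous_chi X m)
    have h2 : ∀ q, pderiv i (fun q => η q * chi X m q) q * u q =
        pderiv i η q * u q * chi X m q +
        2 * Real.pi * I * phase X m (EuclideanSpace.single i 1) * (η q * chi X m q * u q) := by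
      intro q
      rw [pderiv_mul i hη1 (contDiff_chi X m), pderiv_chi]
      ring
    simp only [h2] at h1
    rw [integral_add, integral_const_mul] at h1
    · change pairing (hA i) _ + pairing (hB i) _ = _
      rw [pairing_chiLp, pairing_chiLp]
      have h3 : ∫ q, η q * du i q * chi X m q ∂(area X)
          = ∫ q, η q * chi X m q * du i q ∂(area X) := by
        congr 1; funext q; ring
      rw [h3]
      linear_combination (((√((area X).real Set.univ))⁻¹ : ℝ) : ℂ) * h1
    · refine (integrable_mul_of_continuous (continuous_chi X m) (hB i)).congr
        (Eventually.of_forall fun q => mul_comm _ _)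
    · exact (integrable_mul_of_continuous hc2 (Lp.memLp _)).const_mul _
  have hsum : ∀ i j, HasSum (fun m => inner ℂ (chiLp X m) (dv i) * L j (chiLp X m))
      (L j (dv i)) := by
    intro i j
    have h1 := (L j).hasSum ((chiBasis X).hasSum_repr (dv i))
    refine h1.congr_fun ?_
    intro m
    simp [HilbertBasis.repr_apply_apply, coe_chiBasis]
  -- Expanded in characters, both sides have the same terms: each carries the product of the
  -- frequencies in the two Cartesian directions.
  have heq : L 0 (dv 1) = L 1 (dv 0) := by
    refine (hsum 1 0).unique ((hsum 0 1).congr_fun ?_)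
    intro m
    rw [hchi, hchi, (hv 0).inner_chiLp, (hv 1).inner_chiLp]
    ring
  change pairing (hA 0) _ + pairing (hB 0) _ = pairing (hA 1) _ + pairing (hB 1) _ at heq
  simp only [pairing_apply] at heq
  have h5 : ∫ q, η q * (du 0 q * dv 1 q - du 1 q * dv 0 q) ∂(area X) =
      ∫ q, η q * du 0 q * dv 1 q ∂(area X) - ∫ q, η q * du 1 q * dv 0 q ∂(area X) := by
    rw [← integral_sub]
    · congr 1; funext q; ring
    · exact (hA 0).integrable_mul (Lp.memLp _)
    · exact (hA 1).integrable_mul (Lp.memLp _)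
  rw [h5]
  linear_combination heq

end WeakDerivatives

/-! ### Weak convergence in real Hilbert spaces. -/

section WeakConvergence

variable {H : Type*} [NormedAddCommGroup H] [InnerProductSpace ℝ H]

/-- Weak convergence of a sequence in a real Hilbert space. -/
def WeakTendsto (u : ℕ → H) (u₀ : H) : Prop :=
  ∀ v, Tendsto (fun n => inner ℝ v (u n)) atTop (𝓝 (inner ℝ v u₀))

theorem WeakTendsto.comp {u : ℕ → H} {u₀ : H} (h : WeakTendsto u u₀) {σ : ℕ → ℕ}
    (hσ : StrictMono σ) : WeakTendsto (fun n => u (σ n)) u₀ :=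
  fun v => (h v).comp hσ.tendsto_atTop

theorem WeakTendsto.map_real [CompleteSpace H] {u : ℕ → H} {u₀ : H} (h : WeakTendsto u u₀)
    (L : H →L[ℝ] ℝ) : Tendsto (fun n => L (u n)) atTop (𝓝 (L u₀)) := by
  have := h ((InnerProductSpace.toDual ℝ H).symm L)
  simpa only [InnerProductSpace.toDual_symm_apply] using this

theorem WeakTendsto.map_complex [CompleteSpace H] {u : ℕ → H} {u₀ : H} (h : WeakTendsto u u₀)
    (L : H →L[ℝ] ℂ) : Tendsto (fun n => L (u n)) atTop (𝓝 (L u₀)) := by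
  have h1 := h.map_real (Complex.reCLM.comp L)
  have h2 := h.map_real (Complex.imCLM.comp L)
  have h3 := ((Complex.continuous_ofReal.tendsto _).comp h1).add
    (((Complex.continuous_ofReal.tendsto _).comp h2).mul_const I)
  simpa using h3

/-- Sequential Banach–Alaoglu in the dual, transported by the Riesz isomorphism. -/
theorem exists_weakTendsto [CompleteSpace H] [TopologicalSpace.SeparableSpace H] {u : ℕ → H}
    {K : ℝ} (hK : ∀ n, ‖u n‖ ≤ K) :
    ∃ u₀ : H, ∃ σ : ℕ → ℕ, StrictMono σ ∧ WeakTendsto (fun n => u (σ n)) u₀ := by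
  have hmem : ∀ n, StrongDual.toWeakDual (InnerProductSpace.toDual ℝ H (u n)) ∈
      WeakDual.toStrongDual ⁻¹' Metric.closedBall (0 : StrongDual ℝ H) K := by
    intro n
    simpa using hK n
  obtain ⟨a, -, σ, hσ, ha⟩ := WeakDual.isSeqCompact_closedBall ℝ H 0 K hmem
  refine ⟨(InnerProductSpace.toDual ℝ H).symm (WeakDual.toStrongDual a), σ, hσ, fun v => ?_⟩
  have h1 := ((WeakDual.eval_continuous (𝕜 := ℝ) v).tendsto a).comp ha
  rw [real_inner_comm, InnerProductSpace.toDual_symm_apply]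
  refine Tendsto.congr (fun n => ?_) h1
  rw [real_inner_comm]
  rfl

/-- Strong times weak: the bound on `w n` kills the contribution of `u n - u₀`, and the rest is weak
convergence tested on `u₀`. -/
theorem WeakTendsto.inner_tendsto {u w : ℕ → H} {u₀ w₀ : H} (hw : WeakTendsto w w₀) {K : ℝ}
    (hK : ∀ n, ‖w n‖ ≤ K) (hu : Tendsto u atTop (𝓝 u₀)) :
    Tendsto (fun n => inner ℝ (u n) (w n)) atTop (𝓝 (inner ℝ u₀ w₀)) := by
  have h1 : Tendsto (fun n => inner ℝ (u n - u₀) (w n)) atTop (𝓝 0) := by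
    refine squeeze_zero_norm (a := fun n => ‖u n - u₀‖ * K) (fun n => ?_) ?_
    · exact (norm_inner_le_norm _ _).trans
        (mul_le_mul_of_nonneg_left (hK n) (norm_nonneg _))
    · simpa using (tendsto_iff_norm_sub_tendsto_zero.1 hu).mul_const K
  have h2 := h1.add (hw u₀)
  simpa [inner_sub_left] using h2

end WeakConvergence

/-! ### Passage from vector-valued maps to complex components. -/

section Components

variable {X : Module.Basis (Fin 2) ℝ Plane}

/-- A Cartesian component of a square integrable map, as a complex valued function. -/
def comp (X : Module.Basis (Fin 2) ℝ Plane) (j : Fin 3) :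
    Lp Space 2 (area X) →L[ℝ] Lp ℂ 2 (area X) :=
  (Complex.ofRealCLM.comp (EuclideanSpace.proj j : Space →L[ℝ] ℝ)).compLpL 2 (area X)

theorem coeFn_comp (j : Fin 3) (f : Lp Space 2 (area X)) :
    comp X j f =ᵐ[area X] fun q => ((f q j : ℝ) : ℂ) :=
  ContinuousLinearMap.coeFn_compLpL _ f

theorem tendsto_of_tendsto_comp {f : ℕ → Lp Space 2 (area X)} {f₀ : Lp Space 2 (area X)}
    (h : ∀ j, Tendsto (fun n => comp X j (f n)) atTop (𝓝 (comp X j f₀))) :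
    Tendsto f atTop (𝓝 f₀) := by
  let e : Fin 3 → ℂ →L[ℝ] Space := fun j =>
    Complex.reCLM.smulRight (EuclideanSpace.single j (1 : ℝ))
  have hsum : ∀ f : Lp Space 2 (area X), ∑ j, (e j).compLpL 2 (area X) (comp X j f) = f := by
    intro f
    apply Lp.ext
    rw [Fin.sum_univ_three]
    filter_upwards [Lp.coeFn_add ((e 0).compLpL 2 (area X) (comp X 0 f) +
        (e 1).compLpL 2 (area X) (comp X 1 f)) ((e 2).compLpL 2 (area X) (comp X 2 f)),
      Lp.coeFn_add ((e 0).compLpL 2 (area X) (comp X 0 f))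
        ((e 1).compLpL 2 (area X) (comp X 1 f)),
      (e 0).coeFn_compLpL (comp X 0 f), (e 1).coeFn_compLpL (comp X 1 f),
      (e 2).coeFn_compLpL (comp X 2 f), coeFn_comp 0 f, coeFn_comp 1 f, coeFn_comp 2 f]
      with q h1 h2 h3 h4 h5 h6 h7 h8
    rw [h1, Pi.add_apply, h2, Pi.add_apply, h3, h4, h5, h6, h7, h8]
    ext j
    fin_cases j <;> simp [e]
  have h1 : Tendsto (fun n => ∑ j, (e j).compLpL 2 (area X) (comp X j (f n))) atTop
      (𝓝 (∑ j, (e j).compLpL 2 (area X) (comp X j f₀))) :=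
    tendsto_finsetSum _ fun j _ => (((e j).compLpL 2 (area X)).continuous.tendsto _).comp (h j)
  simpa only [hsum] using h1

/-- Cyclic indices in `Fin 3` allow the three components of the Jacobian to be treated at once. -/
theorem cross_apply (a b : Space) (j : Fin 3) :
    cross a b j = a (j + 1) * b (j + 2) - a (j + 2) * b (j + 1) := by
  fin_cases j <;> simp [cross, crossProduct]

theorem IsWeakDeriv.congr {i : Fin 2} {u u' g g' : Torus X → ℂ} (h : IsWeakDeriv i u g)
    (hu : u =ᵐ[area X] u') (hg : g =ᵐ[area X] g') : IsWeakDeriv i u' g' := by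
  intro η hη
  have h1 := h η hη
  rw [integral_congr_ae (hu.mono fun q hq => congrArg (pderiv i η q * ·) hq),
    integral_congr_ae (hg.mono fun q hq => congrArg (η q * ·) hq)] at h1
  exact h1

theorem IsWeakDeriv.sub {i : Fin 2} {u u' g g' : Lp ℂ 2 (area X)} (h : IsWeakDeriv i u g)
    (h' : IsWeakDeriv i u' g') :
    IsWeakDeriv i (u - u' : Lp ℂ 2 (area X)) (g - g' : Lp ℂ 2 (area X)) := by
  refine IsWeakDeriv.congr (u := fun q => u q - u' q) (g := fun q => g q - g' q) ?_
    (Lp.coeFn_sub u u').symm (Lp.coeFn_sub g g').symm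
  intro η hη
  have hd := continuous_pderiv i (hη.of_le (m := 1) (by simp))
  have hc : Continuous η := continuous_of_lift hη.continuous
  simp only [mul_sub]
  rw [integral_sub (integrable_mul_of_continuous hd (Lp.memLp _))
      (integrable_mul_of_continuous hd (Lp.memLp _)),
    integral_sub (integrable_mul_of_continuous hc (Lp.memLp _))
      (integrable_mul_of_continuous hc (Lp.memLp _)), h η hη, h' η hη]
  ring

theorem integral_mul_ofReal {a : Torus X → ℂ} (ha : Continuous a) {f : Torus X → ℝ}
    (hf : MemLp f 2 (area X)) :
    ∫ q, a q * (f q : ℂ) ∂(area X) =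
      ((∫ q, (a q).re * f q ∂(area X) : ℝ) : ℂ) + ((∫ q, (a q).im * f q ∂(area X) : ℝ) : ℂ) * I := by
  have hint : Integrable (fun q => a q * (f q : ℂ)) (area X) :=
    integrable_mul_of_continuous ha hf.ofReal
  have := integral_re_add_im hint
  rw [← this]
  simp

theorem memLp_apply {f : Torus X → Space} (hf : MemLp f 2 (area X)) (j : Fin 3) :
    MemLp (fun q => f q j) 2 (area X) :=
  (EuclideanSpace.proj j : Space →L[ℝ] ℝ).comp_memLp' hf

/-- Complex test functions, needed in order to test with characters, are split into real and
imaginary parts. -/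
theorem HasWeakPartialDeriv.isWeakDeriv {i : Fin 2} {f g : Torus X → Space}
    (h : HasWeakPartialDeriv i f g) (hf : MemLp f 2 (area X)) (hg : MemLp g 2 (area X))
    (j : Fin 3) : IsWeakDeriv i (fun q => ((f q j : ℝ) : ℂ)) (fun q => ((g q j : ℝ) : ℂ)) := by
  have hreal : ∀ ζ : Torus X → ℝ, IsSmooth ζ →
      ∫ q, pderiv i ζ q * f q j ∂(area X) = -∫ q, ζ q * g q j ∂(area X) := by
    intro ζ hζ
    have hd : Continuous (partialDeriv i ζ) := continuous_pderiv i (hζ.of_le (m := 1) (by simp))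
    have hc : Continuous ζ := continuous_of_lift hζ.continuous
    have hbd : ∀ {a : Torus X → ℝ} {F : Torus X → Space}, Continuous a → MemLp F 2 (area X) →
        Integrable (fun q => a q • F q) (area X) := fun {a F} ha hF => by
      obtain ⟨C, hC⟩ := exists_norm_le ha
      exact (hF.integrable one_le_two).bdd_smul C ha.aestronglyMeasurable_of_compactSpace
        (Eventually.of_forall hC)
    have h1 := congrArg (EuclideanSpace.proj j : Space →L[ℝ] ℝ) (h ζ hζ)
    rw [map_neg, ← ContinuousLinearMap.integral_comp_comm _ (hbd hd hf),
      ← ContinuousLinearMap.integral_comp_comm _ (hbd hc hg)] at h1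
    simpa using! h1
  intro η hη
  have hd := continuous_pderiv i (hη.of_le (m := 1) (by simp))
  have hc : Continuous η := continuous_of_lift hη.continuous
  have hre : IsSmooth fun q => (η q).re := Complex.reCLM.contDiff.comp hη
  have him : IsSmooth fun q => (η q).im := Complex.imCLM.contDiff.comp hη
  have hdre : ∀ q, (pderiv i η q).re = pderiv i (fun q => (η q).re) q := by
    intro q
    obtain ⟨x, rfl⟩ := proj_surjective X q
    rw [pderiv_proj, pderiv_proj]
    have := (Complex.reCLM.hasFDerivAt.comp x
      (hη.differentiable (by simp) x).hasFDerivAt).fderiv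
    exact (congrArg (fun L => L (EuclideanSpace.single i (1 : ℝ))) this).symm
  have hdim : ∀ q, (pderiv i η q).im = pderiv i (fun q => (η q).im) q := by
    intro q
    obtain ⟨x, rfl⟩ := proj_surjective X q
    rw [pderiv_proj, pderiv_proj]
    have := (Complex.imCLM.hasFDerivAt.comp x
      (hη.differentiable (by simp) x).hasFDerivAt).fderiv
    exact (congrArg (fun L => L (EuclideanSpace.single i (1 : ℝ))) this).symm
  rw [integral_mul_ofReal hd (memLp_apply hf j), integral_mul_ofReal hc (memLp_apply hg j)]
  simp only [hdre, hdim]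
  rw [hreal _ hre, hreal _ him]
  push_cast
  ring

/-- Boundedness of the bilinear form `(u, g) ↦ ∫ a u g` on `L²`. -/
theorem norm_integral_mul_mul_le {a : Torus X → ℂ} (ha : Continuous a) :
    ∃ C : ℝ, ∀ u g : Lp ℂ 2 (area X), ‖∫ q, (a q * u q) * g q ∂(area X)‖ ≤ C * ‖u‖ * ‖g‖ := by
  obtain ⟨C, hC⟩ := exists_norm_le ha
  refine ⟨C, fun u g => ?_⟩
  have hm : MemLp (fun q => a q * u q) 2 (area X) := memLp_mul_of_continuous ha (Lp.memLp _)
  rw [← pairing_apply hm, pairing, innerSL_apply_apply]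
  refine (norm_inner_le_norm _ _).trans (mul_le_mul_of_nonneg_right ?_ (norm_nonneg _))
  refine Lp.norm_le_mul_norm_of_ae_le_mul ?_
  filter_upwards [hm.star.coeFn_toLp] with q hq
  rw [hq, Pi.star_apply, norm_star, norm_mul]
  exact mul_le_mul_of_nonneg_right (hC q) (norm_nonneg _)

/-- Strong times weak once more, now with a fixed continuous weight; this is the form in which the
weak Jacobian identity is passed to the limit. -/
theorem tendsto_integral_mul_mul {a : Torus X → ℂ} (ha : Continuous a)
    {u g : ℕ → Lp ℂ 2 (area X)} {u₀ g₀ : Lp ℂ 2 (area X)} (hu : Tendsto u atTop (𝓝 u₀)) {K : ℝ}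
    (hK : ∀ n, ‖g n‖ ≤ K)
    (hg : ∀ L : Lp ℂ 2 (area X) →L[ℂ] ℂ, Tendsto (fun n => L (g n)) atTop (𝓝 (L g₀))) :
    Tendsto (fun n => ∫ q, (a q * u n q) * g n q ∂(area X)) atTop
      (𝓝 (∫ q, (a q * u₀ q) * g₀ q ∂(area X))) := by
  have hm : ∀ u : Lp ℂ 2 (area X), MemLp (fun q => a q * u q) 2 (area X) := fun u =>
    memLp_mul_of_continuous ha (Lp.memLp _)
  obtain ⟨C, hC⟩ := norm_integral_mul_mul_le ha
  have h1 : Tendsto (fun n => ∫ q, (a q * (u n - u₀ : Lp ℂ 2 (area X)) q) * g n q ∂(area X)) atTop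
      (𝓝 0) := by
    refine squeeze_zero_norm (a := fun n => |C| * ‖u n - u₀‖ * K) (fun n => ?_) ?_
    · refine (hC _ _).trans ?_
      have : C * ‖u n - u₀‖ ≤ |C| * ‖u n - u₀‖ :=
        mul_le_mul_of_nonneg_right (le_abs_self C) (norm_nonneg _)
      exact mul_le_mul this (hK n) (norm_nonneg _) (by positivity)
    · simpa using ((tendsto_iff_norm_sub_tendsto_zero.1 hu).const_mul |C|).mul_const K
  have h2 := h1.add (hg (pairing (hm u₀)))
  simp only [pairing_apply, zero_add] at h2
  refine h2.congr fun n => ?_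
  have hi : ∀ u : Lp ℂ 2 (area X), Integrable (fun q => a q * u q * g n q) (area X) := fun u =>
    (hm u).integrable_mul (Lp.memLp _)
  rw [← integral_add (hi _) (hi _)]
  refine integral_congr_ae ?_
  filter_upwards [Lp.coeFn_sub (u n) u₀] with q hq
  rw [hq, Pi.sub_apply]
  ring

end Components

/-! ### Compactness of bounded-energy sequences in a degree class. -/

section Compactness

variable {X : Module.Basis (Fin 2) ℝ Plane}

namespace H1Map

/-- The map itself, as an element of `L²`. -/
def valLp (φ : H1Map X) : Lp Space 2 (area X) := φ.memLp_toFun.toLp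

/-- The weak partial derivatives, as elements of `L²`. -/
def derivLp (φ : H1Map X) (i : Fin 2) : Lp Space 2 (area X) := (φ.memLp_d i).toLp

/-- The cross product of the weak partial derivatives. -/
def jac (φ : H1Map X) (q : Torus X) : Space := cross (φ.d 0 q) (φ.d 1 q)

theorem coeFn_valLp (φ : H1Map X) : φ.valLp =ᵐ[area X] φ.toFun := φ.memLp_toFun.coeFn_toLp

theorem coeFn_derivLp (φ : H1Map X) (i : Fin 2) : φ.derivLp i =ᵐ[area X] φ.d i :=
  (φ.memLp_d i).coeFn_toLp

theorem isWeakDeriv_comp (φ : H1Map X) (i : Fin 2) (j : Fin 3) :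
    IsWeakDeriv i (comp X j φ.valLp) (comp X j (φ.derivLp i)) := by
  refine ((φ.hasWeakPartialDeriv i).isWeakDeriv φ.memLp_toFun (φ.memLp_d i) j).congr ?_ ?_
  · filter_upwards [coeFn_comp j φ.valLp, φ.coeFn_valLp] with q h1 h2
    rw [h1, h2]
  · filter_upwards [coeFn_comp j (φ.derivLp i), φ.coeFn_derivLp i] with q h1 h2
    rw [h1, h2]

/-- The components of `jac φ` in terms of the components of the partial derivatives of `φ`. -/
theorem jac_ae_eq (φ : H1Map X) (j : Fin 3) :
    (fun q => ((φ.jac q j : ℝ) : ℂ)) =ᵐ[area X] fun q =>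
      comp X (j + 1) (φ.derivLp 0) q * comp X (j + 2) (φ.derivLp 1) q -
        comp X (j + 1) (φ.derivLp 1) q * comp X (j + 2) (φ.derivLp 0) q := by
  filter_upwards [coeFn_comp (j + 1) (φ.derivLp 0), coeFn_comp (j + 1) (φ.derivLp 1),
    coeFn_comp (j + 2) (φ.derivLp 0), coeFn_comp (j + 2) (φ.derivLp 1), φ.coeFn_derivLp 0,
    φ.coeFn_derivLp 1] with q h1 h2 h3 h4 h5 h6
  rw [h1, h2, h3, h4, h5, h6, jac, cross_apply]
  push_cast
  ring

/-- The Fourier coefficients of the Jacobian become integrals with a single weak derivative of `φ`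
in each, which are stable under strong convergence of `φ` and weak convergence of its derivatives.
-/
theorem integral_chi_mul_jac (φ : H1Map X) (j : Fin 3) (m : Fin 2 → ℤ) :
    ∫ q, chi X m q * ((φ.jac q j : ℝ) : ℂ) ∂(area X) =
      ∫ q, (pderiv 1 (chi X m) q * comp X (j + 1) φ.valLp q) *
          comp X (j + 2) (φ.derivLp 0) q ∂(area X) -
        ∫ q, (pderiv 0 (chi X m) q * comp X (j + 1) φ.valLp q) *
          comp X (j + 2) (φ.derivLp 1) q ∂(area X) := by
  rw [← integral_jacobian (u := comp X (j + 1) φ.valLp) (v := comp X (j + 2) φ.valLp)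
    (du := fun i => comp X (j + 1) (φ.derivLp i)) (dv := fun i => comp X (j + 2) (φ.derivLp i))
    (fun i => φ.isWeakDeriv_comp i _) (fun i => φ.isWeakDeriv_comp i _) (contDiff_chi X m)]
  refine integral_congr_ae ((φ.jac_ae_eq j).mono fun q hq => ?_)
  simp only at hq
  simp only [hq]

theorem degree_eq (φ : H1Map X) (h : MemLp φ.jac 2 (area X)) :
    degree φ = 1 / (4 * Real.pi) * inner ℝ φ.valLp h.toLp := by
  rw [degree, L2.inner_def]
  congr 1
  refine integral_congr_ae ?_
  filter_upwards [φ.coeFn_valLp, h.coeFn_toLp] with q h1 h2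
  rw [h1, h2, jac]

end H1Map

/-- Puts a component of a vector-valued integral in the form to which weak `L²` convergence applies.
-/
theorem inner_integral_smul {a : Torus X → ℝ} (ha : Continuous a) {f : Torus X → Space}
    (hf : MemLp f 2 (area X)) (v : Space) :
    inner ℝ v (∫ q, a q • f q ∂(area X)) =
      inner ℝ ((memLp_of_continuous (f := fun q => a q • v) (ha.smul continuous_const) 2).toLp)
        hf.toLp := by
  obtain ⟨C, hC⟩ := exists_norm_le ha
  have hint : Integrable (fun q => a q • f q) (area X) :=
    (hf.integrable one_le_two).bdd_smul C ha.aestronglyMeasurable_of_compactSpace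
      (Eventually.of_forall hC)
  rw [← integral_inner hint, L2.inner_def]
  refine integral_congr_ae ?_
  filter_upwards [hf.coeFn_toLp, (memLp_of_continuous (f := fun q => a q • v)
    (ha.smul continuous_const) 2 (X := X)).coeFn_toLp] with q h1 h2
  rw [h1, h2, inner_smul_left, inner_smul_right]
  rfl

/-- Weak derivatives pass to weak limits. -/
theorem hasWeakPartialDeriv_of_weakTendsto {i : Fin 2} {ψ : ℕ → H1Map X}
    {f g : Lp Space 2 (area X)} (hf : WeakTendsto (fun n => (ψ n).valLp) f)
    (hg : WeakTendsto (fun n => (ψ n).derivLp i) g) : HasWeakPartialDeriv i f g := by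
  intro η hη
  have hd : Continuous (partialDeriv i η) := continuous_pderiv i (hη.of_le (m := 1) (by simp))
  have hc : Continuous η := continuous_of_lift hη.continuous
  refine ext_inner_left ℝ fun v => ?_
  rw [inner_neg_right, inner_integral_smul hd (Lp.memLp f), inner_integral_smul hc (Lp.memLp g),
    Lp.toLp_coeFn, Lp.toLp_coeFn]
  refine tendsto_nhds_unique (hf _) ((hg _).neg.congr fun n => ?_)
  simp only [H1Map.valLp, H1Map.derivLp]
  rw [← inner_integral_smul hd, ← inner_integral_smul hc,
    (ψ n).hasWeakPartialDeriv i η hη, inner_neg_right]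

/-- Strong `L²` convergence of sequences that converge weakly in `H¹`. -/
theorem tendsto_valLp {ψ : ℕ → H1Map X} {φ : H1Map X} {K : ℝ}
    (hf : WeakTendsto (fun n => (ψ n).valLp) φ.valLp) (hK : ∀ n i, ‖(ψ n).derivLp i‖ ≤ K) :
    Tendsto (fun n => (ψ n).valLp) atTop (𝓝 φ.valLp) := by
  refine tendsto_of_tendsto_comp fun j => ?_
  rw [← tendsto_sub_nhds_zero_iff]
  refine tendsto_zero_of_tendsto_inner
    (g := fun i n => comp X j ((ψ n).derivLp i) - comp X j (φ.derivLp i))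
    (fun i n => ((ψ n).isWeakDeriv_comp i j).sub (φ.isWeakDeriv_comp i j))
    (K := ‖comp X j‖ * K + (‖comp X j (φ.derivLp 0)‖ + ‖comp X j (φ.derivLp 1)‖))
    (fun i n => ?_) fun m => ?_
  · refine (norm_sub_le _ _).trans (add_le_add (((comp X j).le_opNorm _).trans
      (mul_le_mul_of_nonneg_left (hK n i) (norm_nonneg _))) ?_)
    fin_cases i
    · exact le_add_of_nonneg_right (norm_nonneg _)
    · exact le_add_of_nonneg_left (norm_nonneg _)
  · have h1 := hf.map_complex
      (((innerSL ℂ (chiLp X m)).restrictScalars ℝ).comp (comp X j))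
    rw [← tendsto_sub_nhds_zero_iff] at h1
    refine h1.congr fun n => ?_
    simp [inner_sub_right]

/-- Weak continuity of the Jacobian. -/
theorem jac_ae_eq_of_weakTendsto {ψ : ℕ → H1Map X} {φ : H1Map X} {K : ℝ}
    (hf : Tendsto (fun n => (ψ n).valLp) atTop (𝓝 φ.valLp))
    (hd : ∀ i, WeakTendsto (fun n => (ψ n).derivLp i) (φ.derivLp i))
    (hK : ∀ n i, ‖(ψ n).derivLp i‖ ≤ K) (hJ : ∀ n, MemLp (ψ n).jac 2 (area X))
    {w : Lp Space 2 (area X)} (hw : WeakTendsto (fun n => (hJ n).toLp) w) :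
    φ.jac =ᵐ[area X] w := by
  have hcomp : ∀ j : Fin 3, ∀ᵐ q ∂(area X), φ.jac q j = w q j := by
    intro j
    have hK' : ∀ n i, ‖comp X (j + 2) ((ψ n).derivLp i)‖ ≤ ‖comp X (j + 2)‖ * K := fun n i =>
      ((comp X (j + 2)).le_opNorm _).trans
        (mul_le_mul_of_nonneg_left (hK n i) (norm_nonneg _))
    have hu : Tendsto (fun n => comp X (j + 1) (ψ n).valLp) atTop
        (𝓝 (comp X (j + 1) φ.valLp)) :=
      ((comp X (j + 1)).continuous.tendsto _).comp hf
    have hg : ∀ i, ∀ L : Lp ℂ 2 (area X) →L[ℂ] ℂ,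
        Tendsto (fun n => L (comp X (j + 2) ((ψ n).derivLp i))) atTop
          (𝓝 (L (comp X (j + 2) (φ.derivLp i)))) := fun i L =>
      (hd i).map_complex ((L.restrictScalars ℝ).comp (comp X (j + 2)))
    -- At this stage the limit Jacobian is only known to be integrable, as a combination of products
    -- of `L²` functions; hence the use of Fourier uniqueness in `L¹`.
    have hjint : Integrable (fun q => ((φ.jac q j : ℝ) : ℂ)) (area X) := by
      refine Integrable.congr ?_ (φ.jac_ae_eq j).symm
      exact ((Lp.memLp _).integrable_mul (Lp.memLp _)).sub
        ((Lp.memLp _).integrable_mul (Lp.memLp _))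
    have hwint : Integrable (comp X j w) (area X) := (Lp.memLp _).integrable one_le_two
    have hchi : ∀ m, ∫ q, chi X m q * ((φ.jac q j : ℝ) : ℂ) ∂(area X) =
        ∫ q, chi X m q * comp X j w q ∂(area X) := by
      intro m
      have hc1 : ∀ i, Continuous (pderiv i (chi X m)) := fun i =>
        continuous_pderiv i (contDiff_chi X m)
      have h1 := (tendsto_integral_mul_mul (hc1 1) hu (fun n => hK' n 0) (hg 0)).sub
        (tendsto_integral_mul_mul (hc1 0) hu (fun n => hK' n 1) (hg 1))
      rw [← φ.integral_chi_mul_jac] at h1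
      simp only [← H1Map.integral_chi_mul_jac] at h1
      have hm := memLp_of_continuous (continuous_chi X m) 2
      have h2 := hw.map_complex (((pairing hm).restrictScalars ℝ).comp (comp X j))
      -- The coefficients along the sequence converge to both sides: by the weak Jacobian identity,
      -- and by weak convergence to `w`.
      refine tendsto_nhds_unique h1 ?_
      simp only [ContinuousLinearMap.comp_apply, ContinuousLinearMap.coe_restrictScalars',
        pairing_apply] at h2
      refine h2.congr fun n => integral_congr_ae ?_
      filter_upwards [coeFn_comp j (hJ n).toLp, (hJ n).coeFn_toLp] with q h3 h4
      rw [h3, h4]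
    have hzero := ae_eq_zero_of_integral_chi_mul_eq_zero (hjint.sub hwint) fun m => by
      have hb : ∀ f : Torus X → ℂ, Integrable f (area X) →
          Integrable (fun q => chi X m q * f q) (area X) := fun f hf =>
        hf.bdd_mul (continuous_chi X m).aestronglyMeasurable_of_compactSpace
          (Eventually.of_forall fun q => (norm_chi X m q).le)
      simp only [Pi.sub_apply, mul_sub]
      rw [integral_sub (hb _ hjint) (hb _ hwint), hchi m, sub_self]
    filter_upwards [hzero, coeFn_comp j w] with q h1 h2
    rw [Pi.sub_apply, h2, Pi.zero_apply, sub_eq_zero] at h1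
    exact_mod_cast h1
  filter_upwards [ae_all_iff.2 hcomp] with q hq
  ext j
  exact hq j

/-- A sequence of sphere valued maps of degree `k` with bounded energy has a subsequence that
converges to a map of the same kind: almost everywhere, and weakly in `L²` together with its first
derivatives and their cross product. -/
theorem exists_subseq_tendsto {k : ℤ} {ψ : ℕ → H1Map X} (hψ : ∀ n, ψ n ∈ degreeClass X k)
    (hJ : ∀ n, MemLp (ψ n).jac 2 (area X)) {K : ℝ} (hK : ∀ n i, ‖(ψ n).derivLp i‖ ≤ K)
    (hKJ : ∀ n, ‖(hJ n).toLp‖ ≤ K) :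
    ∃ φ ∈ degreeClass X k, ∃ hφ : MemLp φ.jac 2 (area X), ∃ σ : ℕ → ℕ, StrictMono σ ∧
      (∀ᵐ q ∂(area X), Tendsto (fun n => (ψ (σ n)).toFun q) atTop (𝓝 (φ.toFun q))) ∧
      (∀ i, WeakTendsto (fun n => (ψ (σ n)).derivLp i) (φ.derivLp i)) ∧
      WeakTendsto (fun n => (hJ (σ n)).toLp) hφ.toLp := by
  have : Fact ((2 : ℝ≥0∞) ≠ ⊤) := ⟨ENNReal.ofNat_ne_top⟩
  have : IsSeparable (area X) := isSeparable_of_sigmaFinite _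
  have hval : ∀ n, ‖(ψ n).valLp‖ ≤ (area X).real Set.univ ^ (2⁻¹ : ℝ) := by
    intro n
    have := Lp.norm_le_of_ae_bound (f := (ψ n).valLp) (C := 1) zero_le_one (by
      filter_upwards [(ψ n).coeFn_valLp, (hψ n).1] with q h1 h2
      rw [h1, h2])
    simpa [measureUnivNNReal, measureReal_def] using! this
  obtain ⟨f, σ₁, hσ₁, hf⟩ := exists_weakTendsto hval
  obtain ⟨g₀, σ₂, hσ₂, hg₀⟩ := exists_weakTendsto fun n => hK (σ₁ n) 0
  obtain ⟨g₁, σ₃, hσ₃, hg₁⟩ := exists_weakTendsto fun n => hK (σ₁ (σ₂ n)) 1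
  obtain ⟨w, σ₄, hσ₄, hw⟩ := exists_weakTendsto fun n => hKJ (σ₁ (σ₂ (σ₃ n)))
  set τ : ℕ → ℕ := fun n => σ₁ (σ₂ (σ₃ (σ₄ n))) with hτ
  have hτm : StrictMono τ := hσ₁.comp (hσ₂.comp (hσ₃.comp hσ₄))
  have hf' : WeakTendsto (fun n => (ψ (τ n)).valLp) f := hf.comp (hσ₂.comp (hσ₃.comp hσ₄))
  have hg₀' : WeakTendsto (fun n => (ψ (τ n)).derivLp 0) g₀ := hg₀.comp (hσ₃.comp hσ₄)
  have hg₁' : WeakTendsto (fun n => (ψ (τ n)).derivLp 1) g₁ := hg₁.comp hσ₄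
  let φ : H1Map X :=
    { toFun := f
      d := ![g₀, g₁]
      memLp_toFun := Lp.memLp f
      memLp_d := fun i => by
        fin_cases i
        · exact Lp.memLp g₀
        · exact Lp.memLp g₁
      hasWeakPartialDeriv := fun i => by
        fin_cases i
        · exact hasWeakPartialDeriv_of_weakTendsto (ψ := fun n => ψ (τ n)) hf' hg₀'
        · exact hasWeakPartialDeriv_of_weakTendsto (ψ := fun n => ψ (τ n)) hf' hg₁' }
  have hφv : φ.valLp = f := Lp.toLp_coeFn f _
  have hφ₀ : φ.derivLp 0 = g₀ := Lp.toLp_coeFn g₀ _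
  have hφ₁ : φ.derivLp 1 = g₁ := Lp.toLp_coeFn g₁ _
  have hd : ∀ i, WeakTendsto (fun n => (ψ (τ n)).derivLp i) (φ.derivLp i) := by
    intro i
    fin_cases i
    · exact hφ₀ ▸ hg₀'
    · exact hφ₁ ▸ hg₁'
  have hs : Tendsto (fun n => (ψ (τ n)).valLp) atTop (𝓝 φ.valLp) :=
    tendsto_valLp (hφv.symm ▸ hf') fun n => hK (τ n)
  have hae := jac_ae_eq_of_weakTendsto (ψ := fun n => ψ (τ n)) hs hd (fun n => hK (τ n))
    (fun n => hJ (τ n)) hw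
  -- Square integrability of the limit Jacobian is inherited from its identification with the weak
  -- limit `w`.
  have hφJ : MemLp φ.jac 2 (area X) := (memLp_congr_ae hae).2 (Lp.memLp w)
  have hφw : hφJ.toLp = w := by
    rw [← Lp.toLp_coeFn w (Lp.memLp w)]
    exact MemLp.toLp_congr _ _ hae
  obtain ⟨ρ, hρ, hρae⟩ := (tendstoInMeasure_of_tendsto_Lp hs).exists_seq_tendsto_ae
  have hconv : ∀ᵐ q ∂(area X),
      Tendsto (fun n => (ψ (τ (ρ n))).toFun q) atTop (𝓝 (φ.toFun q)) := by
    filter_upwards [hρae, ae_all_iff.2 fun n => (ψ (τ (ρ n))).coeFn_valLp, φ.coeFn_valLp]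
      with q h1 h2 h3
    rw [← h3]
    exact h1.congr h2
  refine ⟨φ, ⟨?_, ?_⟩, hφJ, fun n => τ (ρ n), hτm.comp hρ, hconv, fun i => (hd i).comp hρ,
    hφw.symm ▸ hw.comp hρ⟩
  · filter_upwards [hconv, ae_all_iff.2 fun n => (hψ (τ (ρ n))).1] with q h1 h2
    exact tendsto_nhds_unique h1.norm (by simp [h2])
  -- The degree pairs the strongly convergent maps with the weakly convergent Jacobians, so the
  -- constant value `k` survives in the limit.
  · have h1 := (WeakTendsto.inner_tendsto hw (fun n => hKJ (τ n)) hs).const_mul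
      (1 / (4 * Real.pi))
    rw [φ.degree_eq hφJ, hφw]
    refine tendsto_nhds_unique h1 ?_
    have : ∀ n, 1 / (4 * Real.pi) * inner ℝ (ψ (τ n)).valLp (hJ (τ n)).toLp = k := fun n => by
      rw [← (ψ (τ n)).degree_eq, (hψ (τ n)).2]
    simp only [hτ] at this
    simp only [hτ, this]
    exact tendsto_const_nhds

end Compactness

/-! ### The energy functional and the direct method. -/

section Minimization

variable {X : Module.Basis (Fin 2) ℝ Plane}

theorem continuous_cross : Continuous fun p : Space × Space => cross p.1 p.2 := by
  refine (PiLp.continuous_toLp 2 _).comp (continuous_pi fun j => ?_)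
  fin_cases j <;> simp [crossProduct] <;> fun_prop

theorem H1Map.aestronglyMeasurable_jac (φ : H1Map X) : AEStronglyMeasurable φ.jac (area X) :=
  continuous_cross.comp_aestronglyMeasurable ((φ.memLp_d 0).1.prodMk (φ.memLp_d 1).1)

/-- The potential energy. -/
def potential (V : Sphere → ℝ) (φ : H1Map X) : ℝ :=
  ∫ q, Function.extend Subtype.val V (fun _ => 0) (φ.toFun q) ∂(area X)

/-- The energy of a map whose Jacobian is square integrable. -/
def realEnergy (V : Sphere → ℝ) (φ : H1Map X) (h : MemLp φ.jac 2 (area X)) : ℝ :=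
  1 / 2 * ‖φ.derivLp 0‖ ^ 2 + 1 / 2 * ‖φ.derivLp 1‖ ^ 2 + 1 / 2 * ‖h.toLp‖ ^ 2 + potential V φ

theorem norm_toLp_sq {f : Torus X → Space} (hf : MemLp f 2 (area X)) :
    ‖hf.toLp‖ ^ 2 = ∫ q, ‖f q‖ ^ 2 ∂(area X) := by
  rw [← real_inner_self_eq_norm_sq, L2.inner_def]
  refine integral_congr_ae ?_
  filter_upwards [hf.coeFn_toLp] with q hq
  rw [hq, real_inner_self_eq_norm_sq]

theorem energy_eq_realEnergy (V : Sphere → ℝ) (φ : H1Map X) (h : MemLp φ.jac 2 (area X)) :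
    energy V φ = (realEnergy V φ h : EReal) := by
  have hi : ∀ {f : Torus X → Space}, MemLp f 2 (area X) →
      Integrable (fun q => 1 / 2 * ‖f q‖ ^ 2) (area X) := fun hf =>
    ((memLp_two_iff_integrable_sq_norm hf.1).1 hf).const_mul _
  have h0 := hi (φ.memLp_d 0)
  have h1 := hi (φ.memLp_d 1)
  have h2 := hi h
  have hint : ∫ q, (1 / 2 * ‖φ.d 0 q‖ ^ 2 + 1 / 2 * ‖φ.d 1 q‖ ^ 2 + 1 / 2 * ‖φ.jac q‖ ^ 2) ∂(area X)
      = 1 / 2 * ‖φ.derivLp 0‖ ^ 2 + 1 / 2 * ‖φ.derivLp 1‖ ^ 2 + 1 / 2 * ‖h.toLp‖ ^ 2 := by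
    have h01 : Integrable (fun q => 1 / 2 * ‖φ.d 0 q‖ ^ 2 + 1 / 2 * ‖φ.d 1 q‖ ^ 2) (area X) :=
      h0.add h1
    rw [integral_add h01 h2, integral_add h0 h1, integral_const_mul, integral_const_mul,
      integral_const_mul, H1Map.derivLp, H1Map.derivLp, norm_toLp_sq, norm_toLp_sq, norm_toLp_sq]
  have hl := ofReal_integral_eq_lintegral_ofReal ((h0.add h1).add h2)
    (Eventually.of_forall fun q => by
      change 0 ≤ 1 / 2 * ‖φ.d 0 q‖ ^ 2 + 1 / 2 * ‖φ.d 1 q‖ ^ 2 + 1 / 2 * ‖φ.jac q‖ ^ 2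
      positivity)
  rw [energy, realEnergy, EReal.coe_add, ← potential, ← hint]
  congr 1
  refine (congrArg ENNReal.toEReal hl.symm).trans ?_
  rw [EReal.coe_ennreal_ofReal, max_eq_left]
  · rfl
  · exact integral_nonneg fun q => by
      change 0 ≤ 1 / 2 * ‖φ.d 0 q‖ ^ 2 + 1 / 2 * ‖φ.d 1 q‖ ^ 2 + 1 / 2 * ‖φ.jac q‖ ^ 2
      positivity

theorem energy_eq_top (V : Sphere → ℝ) (φ : H1Map X) (h : ¬MemLp φ.jac 2 (area X)) :
    energy V φ = ⊤ := by
  have htop : ∫⁻ q, ENNReal.ofReal (1 / 2 * ‖φ.d 0 q‖ ^ 2 + 1 / 2 * ‖φ.d 1 q‖ ^ 2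
      + 1 / 2 * ‖cross (φ.d 0 q) (φ.d 1 q)‖ ^ 2) ∂(area X) = ⊤ := by
    by_contra hne
    refine h ((memLp_two_iff_integrable_sq_norm φ.aestronglyMeasurable_jac).2
      ⟨(φ.aestronglyMeasurable_jac.norm.pow 2), ?_⟩)
    have h1 : Integrable (fun q => 1 / 2 * ‖φ.jac q‖ ^ 2) (area X) := by
      refine ⟨(φ.aestronglyMeasurable_jac.norm.pow 2).const_mul _, ?_⟩
      rw [hasFiniteIntegral_iff_ofReal (Eventually.of_forall fun q => by positivity)]
      refine lt_of_le_of_lt (lintegral_mono fun q => ENNReal.ofReal_le_ofReal ?_)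
        (lt_top_iff_ne_top.2 hne)
      change _ ≤ 1 / 2 * ‖φ.d 0 q‖ ^ 2 + 1 / 2 * ‖φ.d 1 q‖ ^ 2 + 1 / 2 * ‖φ.jac q‖ ^ 2
      have : 0 ≤ 1 / 2 * ‖φ.d 0 q‖ ^ 2 + 1 / 2 * ‖φ.d 1 q‖ ^ 2 := by positivity
      linarith
    have h2 := h1.const_mul 2
    simp only [← mul_assoc] at h2
    norm_num at h2
    exact h2.2
  rw [energy, htop, EReal.coe_ennreal_top, EReal.top_add_coe]

/-- A finite convex function on a finite-dimensional space is continuous. Convexity enters only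
here; everything else uses continuity of the extension. -/
theorem HasConvexExtension.exists_continuous {V : Sphere → ℝ} (hV : HasConvexExtension V) :
    ∃ F : Space → ℝ, Continuous F ∧
      ∀ p : Space, ‖p‖ = 1 → Function.extend Subtype.val V (fun _ => 0) p = F p := by
  obtain ⟨F, hF, hFV⟩ := hV
  refine ⟨F, continuousOn_univ.1 (hF.continuousOn isOpen_univ), fun p hp => ?_⟩
  have := Subtype.val_injective.extend_apply V (fun _ => 0)
    (⟨p, mem_sphere_zero_iff_norm.2 hp⟩ : Sphere)
  exact this.trans (hFV _).symm

/-- The sphere is compact, so the potential energy is bounded on sphere valued maps. -/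
theorem HasConvexExtension.exists_abs_potential_le {V : Sphere → ℝ} (hV : HasConvexExtension V) :
    ∃ M : ℝ, ∀ φ : H1Map X, (∀ᵐ q ∂(area X), ‖φ.toFun q‖ = 1) → |potential V φ| ≤ M := by
  obtain ⟨F, hF, hFV⟩ := hV.exists_continuous
  obtain ⟨C, hC⟩ := (isCompact_sphere (0 : Space) 1).exists_bound_of_continuousOn hF.continuousOn
  refine ⟨C * (area X).real Set.univ, fun φ hφ => ?_⟩
  rw [← Real.norm_eq_abs, potential]
  refine norm_integral_le_of_norm_le_const ?_
  filter_upwards [hφ] with q hq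
  rw [hFV _ hq]
  exact hC _ (mem_sphere_zero_iff_norm.2 hq)

theorem HasConvexExtension.tendsto_potential {V : Sphere → ℝ} (hV : HasConvexExtension V)
    {ψ : ℕ → H1Map X} {φ : H1Map X} (hψ : ∀ n, ∀ᵐ q ∂(area X), ‖(ψ n).toFun q‖ = 1)
    (hφ : ∀ᵐ q ∂(area X), ‖φ.toFun q‖ = 1)
    (h : ∀ᵐ q ∂(area X), Tendsto (fun n => (ψ n).toFun q) atTop (𝓝 (φ.toFun q))) :
    Tendsto (fun n => potential V (ψ n)) atTop (𝓝 (potential V φ)) := by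
  obtain ⟨F, hF, hFV⟩ := hV.exists_continuous
  obtain ⟨C, hC⟩ := (isCompact_sphere (0 : Space) 1).exists_bound_of_continuousOn hF.continuousOn
  have heq : ∀ φ : H1Map X, (∀ᵐ q ∂(area X), ‖φ.toFun q‖ = 1) →
      potential V φ = ∫ q, F (φ.toFun q) ∂(area X) := fun φ hφ =>
    integral_congr_ae (hφ.mono fun q hq => hFV _ hq)
  rw [heq φ hφ]
  simp only [fun n => heq (ψ n) (hψ n)]
  refine tendsto_integral_of_dominated_convergence (fun _ => C)
    (fun n => hF.comp_aestronglyMeasurable (ψ n).memLp_toFun.1) (integrable_const C)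
    (fun n => (hψ n).mono fun q hq => hC _ (mem_sphere_zero_iff_norm.2 hq))
    (h.mono fun q hq => (hF.tendsto _).comp hq)

/-- The direct method: the energy attains its minimum on a nonempty degree class. -/
theorem exists_isMinOn_energy {V : Sphere → ℝ} (hV : HasConvexExtension V) {k : ℤ}
    (hne : (degreeClass X k).Nonempty) :
    ∃ φ ∈ degreeClass X k, ∀ ψ ∈ degreeClass X k, energy V φ ≤ energy V ψ := by
  -- Without a map of finite energy in the class, every member has energy `⊤` and is a minimizer.
  by_cases hfin : ∃ ψ ∈ degreeClass X k, MemLp ψ.jac 2 (area X)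
  swap
  · obtain ⟨φ, hφ⟩ := hne
    refine ⟨φ, hφ, fun ψ hψ => ?_⟩
    rw [energy_eq_top V ψ fun h => hfin ⟨ψ, hψ, h⟩]
    exact le_top
  obtain ⟨M, hM⟩ := hV.exists_abs_potential_le (X := X)
  let S : Set ℝ := {r | ∃ ψ ∈ degreeClass X k, ∃ h : MemLp ψ.jac 2 (area X), r = realEnergy V ψ h}
  have hSne : S.Nonempty := by
    obtain ⟨ψ, hψ, h⟩ := hfin
    exact ⟨_, ψ, hψ, h, rfl⟩
  have hSbdd : BddBelow S := by
    refine ⟨-M, ?_⟩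
    rintro _ ⟨ψ, hψ, h, rfl⟩
    have h1 := (abs_le.1 (hM ψ hψ.1)).1
    have h2 : 0 ≤ 1 / 2 * ‖ψ.derivLp 0‖ ^ 2 + 1 / 2 * ‖ψ.derivLp 1‖ ^ 2 + 1 / 2 * ‖h.toLp‖ ^ 2 := by
      positivity
    rw [realEnergy]
    linarith
  obtain ⟨r, -, hr, hrS⟩ := exists_seq_tendsto_sInf hSne hSbdd
  choose ψ hψ hJ hrψ using hrS
  obtain ⟨B, hB⟩ := hr.bddAbove_range
  have hbound : ∀ n, 1 / 2 * ‖(ψ n).derivLp 0‖ ^ 2 + 1 / 2 * ‖(ψ n).derivLp 1‖ ^ 2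
      + 1 / 2 * ‖(hJ n).toLp‖ ^ 2 ≤ B + M := by
    intro n
    have h1 := (abs_le.1 (hM (ψ n) (hψ n).1)).1
    have h2 : r n ≤ B := hB ⟨n, rfl⟩
    rw [hrψ n, realEnergy] at h2
    linarith
  have hsqrt : ∀ x : ℝ, 1 / 2 * x ^ 2 ≤ B + M → x ≤ √(2 * (B + M)) := fun x hx =>
    Real.le_sqrt_of_sq_le (by linarith)
  have hKd : ∀ n i, ‖(ψ n).derivLp i‖ ≤ √(2 * (B + M)) := by
    intro n i
    refine hsqrt _ ((hbound n).trans' ?_)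
    have h0 := sq_nonneg ‖(ψ n).derivLp 0‖
    have h1 := sq_nonneg ‖(ψ n).derivLp 1‖
    have h2 := sq_nonneg ‖(hJ n).toLp‖
    fin_cases i <;> simp only [Fin.zero_eta, Fin.mk_one] <;> linarith
  have hKJ : ∀ n, ‖(hJ n).toLp‖ ≤ √(2 * (B + M)) := by
    intro n
    refine hsqrt _ ((hbound n).trans' ?_)
    have h0 := sq_nonneg ‖(ψ n).derivLp 0‖
    have h1 := sq_nonneg ‖(ψ n).derivLp 1‖
    linarith
  obtain ⟨φ, hφ, hφJ, σ, hσ, hae, hd, hw⟩ := exists_subseq_tendsto hψ hJ hKd hKJ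
  have hpot := hV.tendsto_potential (fun n => (hψ (σ n)).1) hφ.1 hae
  -- Lower semicontinuity without a lower limit: `½‖a n‖²` is bounded below by its tangent at `b`,
  -- which is affine in `a n` and so converges under weak convergence, to `½‖b‖²`.
  have hlow : ∀ {a : ℕ → Lp Space 2 (area X)} {b : Lp Space 2 (area X)}, WeakTendsto a b →
      Tendsto (fun n => inner ℝ b (a n) - 1 / 2 * ‖b‖ ^ 2) atTop (𝓝 (1 / 2 * ‖b‖ ^ 2)) := by
    intro a b hab
    have := (hab b).sub_const (1 / 2 * ‖b‖ ^ 2)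
    rw [real_inner_self_eq_norm_sq] at this
    convert this using 2
    ring
  have hyoung : ∀ a b : Lp Space 2 (area X), inner ℝ b a - 1 / 2 * ‖b‖ ^ 2 ≤ 1 / 2 * ‖a‖ ^ 2 := by
    intro a b
    have h1 := norm_sub_sq_real b a
    have h2 := sq_nonneg ‖b - a‖
    linarith
  have hmin : realEnergy V φ hφJ ≤ sInf S := by
    refine le_of_tendsto_of_tendsto'
      ((((hlow (hd 0)).add (hlow (hd 1))).add (hlow hw)).add hpot)
      (hr.comp hσ.tendsto_atTop) fun n => ?_
    rw [Function.comp_apply, hrψ, realEnergy]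
    exact add_le_add (add_le_add (add_le_add (hyoung _ _) (hyoung _ _)) (hyoung _ _)) le_rfl
  refine ⟨φ, hφ, fun ρ hρ => ?_⟩
  by_cases hρJ : MemLp ρ.jac 2 (area X)
  · rw [energy_eq_realEnergy V φ hφJ, energy_eq_realEnergy V ρ hρJ, EReal.coe_le_coe_iff]
    exact hmin.trans (csInf_le hSbdd ⟨ρ, hρ, hρJ, rfl⟩)
  · rw [energy_eq_top V ρ hρJ]
    exact le_top

end Minimization

/-! ### Ingredients for explicit maps: coordinates, a profile curve, the area. -/

section Nonempty

variable {X : Module.Basis (Fin 2) ℝ Plane} {E : Type*}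

/-- The function on the torus with a given periodic lift. -/
def descend {F : Plane → E} (hF : ∀ x, ∀ y ∈ periodLattice X, F (x + y) = F x) : Torus X → E :=
  Quotient.lift F (by
    intro x y hxy
    have h : -x + y ∈ periodLattice X := QuotientAddGroup.leftRel_apply.1 hxy
    rw [← hF x _ h, add_neg_cancel_left])

/-- A continuously differentiable map on the torus, as a map of class `H¹`. -/
def H1Map.ofContDiff (f : Torus X → Space) (hf : ContDiff ℝ 1 fun x => f (proj X x)) :
    H1Map X where
  toFun := f
  d i := pderiv i f
  memLp_toFun := memLp_of_continuous (continuous_of_lift hf.continuous) 2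
  memLp_d i := memLp_of_continuous (continuous_pderiv i hf) 2
  hasWeakPartialDeriv i η hη := by
    have hη1 : ContDiff ℝ 1 fun x => η (proj X x) := hη.of_le (by simp)
    have h := integral_pderiv_eq_zero i (f := fun q => η q • f q) (hη1.smul hf)
    simp only [pderiv_smul i hη1 hf] at h
    rw [integral_add] at h
    · exact eq_neg_of_add_eq_zero_left h
    · exact integrable_of_continuous
        ((continuous_pderiv i hη1).smul (continuous_of_lift hf.continuous))
    · exact integrable_of_continuous
        ((continuous_of_lift hη1.continuous).smul (continuous_pderiv i hf))

/-- The `j`-th coordinate with respect to the basis of periods. -/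
def coordL (X : Module.Basis (Fin 2) ℝ Plane) (j : Fin 2) : Plane →L[ℝ] ℝ :=
  LinearMap.toContinuousLinearMap (X.coord j)

theorem coordL_basis (j : Fin 2) : coordL X j (X j) = 1 := by simp [coordL]

theorem exists_coordL_eq_int (j : Fin 2) {y : Plane} (hy : y ∈ periodLattice X) :
    ∃ n : ℤ, coordL X j y = n := by
  obtain ⟨n, hn⟩ := (X.mem_span_iff_repr_mem ℤ y).1 hy j
  exact ⟨n, by simpa [coordL] using hn.symm⟩

theorem periodic_coordL {F : Type*} {g : ℝ → F} (hg : Function.Periodic g 1) (j : Fin 2) (x : Plane)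
    {y : Plane} (hy : y ∈ periodLattice X) : g (coordL X j (x + y)) = g (coordL X j x) := by
  obtain ⟨n, hn⟩ := exists_coordL_eq_int j hy
  rw [map_add, hn]
  simpa using hg.int_mul n (coordL X j x)

/-- Integration over the torus of a function of one coordinate only. -/
theorem integral_coordL {g : ℝ → ℝ} (hg : Continuous g) (hp : Function.Periodic g 1) (j : Fin 2)
    {f : Torus X → ℝ} (hf : ∀ x, f (proj X x) = g (coordL X j x)) :
    ∫ q, f q ∂(area X) = (area X).real Set.univ * ∫ s in (0 : ℝ)..1, g s := by
  set m := ∫ s in (0 : ℝ)..1, g s with hm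
  -- Subtracting the mean makes the primitive periodic, so it descends to the torus. Its derivative
  -- along `X j` is `f - m`, which therefore integrates to zero.
  let h : ℝ → ℝ := fun s => (∫ r in (0 : ℝ)..s, g r) - m * s
  have hderiv : ∀ s, HasDerivAt h (g s - m) s := fun s => by
    have h0 : HasDerivAt (fun s => m * s) m s := by simpa using (hasDerivAt_id' s).const_mul m
    exact (intervalIntegral.integral_hasDerivAt_right (hg.intervalIntegrable _ _)
      hg.aestronglyMeasurable.stronglyMeasurableAtFilter hg.continuousAt).sub h0
  have hh : ContDiff ℝ 1 h := by
    refine contDiff_one_iff_deriv.2 ⟨fun s => (hderiv s).differentiableAt, ?_⟩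
    rw [funext fun s => (hderiv s).deriv]
    exact hg.sub continuous_const
  have hper : Function.Periodic h 1 := fun s => by
    have h1 := hp.intervalIntegral_add_eq s 0
    have h2 := intervalIntegral.integral_add_adjacent_intervals (hg.intervalIntegrable 0 s)
      (hg.intervalIntegrable s (s + 1)) (μ := volume)
    simp only [h]
    rw [← h2, h1, zero_add, ← hm]
    ring
  let H : Torus X → ℝ := descend (X := X) (F := fun x => h (coordL X j x)) fun x y hy =>
    periodic_coordL hper j x hy
  have hH : ContDiff ℝ 1 fun x => H (proj X x) := hh.comp (coordL X j).contDiff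
  have hfd : ∀ q, ∑ i, X j i * pderiv i H q = f q - m := by
    intro q
    obtain ⟨x, rfl⟩ := proj_surjective X q
    have h1 : HasFDerivAt (fun x => H (proj X x)) ((g (coordL X j x) - m) • coordL X j) x :=
      (hderiv _).comp_hasFDerivAt x (coordL X j).hasFDerivAt
    simp only [pderiv_proj, h1.fderiv]
    rw [hf]
    have h2 := congrArg (coordL X j) ((EuclideanSpace.basisFun (Fin 2) ℝ).sum_repr (X j))
    rw [coordL_basis] at h2
    simp only [map_sum, map_smul, EuclideanSpace.basisFun_repr, EuclideanSpace.basisFun_apply,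
      smul_eq_mul] at h2
    simp only [_root_.smul_apply, smul_eq_mul]
    calc _ = (g (coordL X j x) - m) * ∑ i, X j i * coordL X j (EuclideanSpace.single i 1) := by
          rw [Finset.mul_sum]; exact Finset.sum_congr rfl fun i _ => by ring
      _ = _ := by rw [h2, mul_one]
  have hfc : Continuous f := by
    refine continuous_of_lift ?_
    simp only [hf]
    exact hg.comp (coordL X j).continuous
  have hzero : ∫ q, (f q - m) ∂(area X) = 0 := by
    simp only [← hfd]
    rw [integral_finsetSum _ fun i _ =>
      (integrable_of_continuous (continuous_pderiv i hH)).const_mul _]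
    refine Finset.sum_eq_zero fun i _ => ?_
    rw [integral_const_mul, integral_pderiv_eq_zero i hH, mul_zero]
  rw [integral_sub (integrable_of_continuous hfc) (integrable_const _), integral_const,
    smul_eq_mul, sub_eq_zero] at hzero
  exact hzero

theorem hasDerivAt_max_zero_sq (x : ℝ) : HasDerivAt (fun x : ℝ => max x 0 ^ 2) (2 * max x 0) x := by
  rcases lt_trichotomy x 0 with hx | rfl | hx
  · rw [max_eq_right hx.le, mul_zero]
    refine (hasDerivAt_const x (0 : ℝ)).congr_of_eventuallyEq ?_
    filter_upwards [eventually_lt_nhds hx] with y hy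
    simp [max_eq_right hy.le]
  · rw [max_self, mul_zero, hasDerivAt_iff_isLittleO_nhds_zero]
    refine (Asymptotics.IsBigO.of_bound 1 (Eventually.of_forall fun h => ?_)).trans_isLittleO
      (Asymptotics.isLittleO_pow_id one_lt_two)
    simp only [zero_add, max_self, smul_zero, sub_zero, one_mul, norm_pow, ne_eq,
      OfNat.ofNat_ne_zero, not_false_eq_true, zero_pow]
    refine pow_le_pow_left₀ (norm_nonneg _) ?_ 2
    rw [Real.norm_eq_abs, Real.norm_eq_abs, abs_of_nonneg (le_max_right _ _)]
    exact max_le (le_abs_self h) (abs_nonneg h)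
  · rw [max_eq_left hx.le]
    have := hasDerivAt_pow 2 x
    simp only [Nat.cast_ofNat, Nat.add_one_sub_one, pow_one] at this
    refine this.congr_of_eventuallyEq ?_
    filter_upwards [eventually_gt_nhds hx] with y hy
    rw [max_eq_left hy.le]

theorem contDiff_max_zero_sq : ContDiff ℝ 1 fun x : ℝ => max x 0 ^ 2 := by
  refine contDiff_one_iff_deriv.2 ⟨fun x => (hasDerivAt_max_zero_sq x).differentiableAt, ?_⟩
  rw [funext fun x => (hasDerivAt_max_zero_sq x).deriv]
  fun_prop

/-- A closed curve on the sphere, running from one pole to the other with second coordinate `a`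
and back with second coordinate `b`. -/
theorem exists_profile : ∃ a b c : ℝ → ℝ, (ContDiff ℝ 1 a ∧ ContDiff ℝ 1 b ∧ ContDiff ℝ 1 c) ∧
    (Function.Periodic a 1 ∧ Function.Periodic b 1 ∧ Function.Periodic c 1) ∧
    (∀ s, a s * b s = 0) ∧ (∀ s, a s * deriv b s = 0) ∧ (∀ s, a s ^ 2 + b s ^ 2 + c s ^ 2 = 1) ∧
    ∫ s in (0 : ℝ)..1, (c s * a s * deriv a s - deriv c s * a s ^ 2) = 2 := by
  let u : ℝ → ℝ := fun s => Real.sin (2 * Real.pi * s)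
  let v : ℝ → ℝ := fun s => Real.cos (2 * Real.pi * s)
  have hu : ContDiff ℝ 1 u := by fun_prop
  have hv : ContDiff ℝ 1 v := by fun_prop
  have hup : Function.Periodic u 1 := fun s => by
    simp only [u, mul_add, mul_one, Real.sin_add_two_pi]
  have hvp : Function.Periodic v 1 := fun s => by
    simp only [v, mul_add, mul_one, Real.cos_add_two_pi]
  -- Squares of positive parts are `C¹` with disjoint supports up to their zeros. Here `a² + b² =
  -- u⁴`, and `c² = (1 - u²)(1 + u²) = 1 - u⁴`.
  let a : ℝ → ℝ := fun s => max (u s) 0 ^ 2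
  let b : ℝ → ℝ := fun s => max (-u s) 0 ^ 2
  let c : ℝ → ℝ := fun s => v s * √(1 + u s ^ 2)
  have ha : ContDiff ℝ 1 a := contDiff_max_zero_sq.comp hu
  have hb : ContDiff ℝ 1 b := contDiff_max_zero_sq.comp hu.neg
  have hc : ContDiff ℝ 1 c := hv.mul ((contDiff_const.add (hu.pow 2)).sqrt fun s => by positivity)
  have hsq : ∀ s, a s ^ 2 + b s ^ 2 + c s ^ 2 = 1 := by
    intro s
    have h1 : u s ^ 2 + v s ^ 2 = 1 := Real.sin_sq_add_cos_sq _
    simp only [a, b, c]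
    rw [mul_pow, Real.sq_sqrt (by positivity)]
    rcases le_total (u s) 0 with h | h
    · rw [max_eq_right h, max_eq_left (neg_nonneg.2 h)]
      linear_combination (1 + u s ^ 2) * h1
    · rw [max_eq_left h, max_eq_right (neg_nonpos.2 h)]
      linear_combination (1 + u s ^ 2) * h1
  have hab : ∀ s, a s * b s = 0 := by
    intro s
    simp only [a, b]
    rcases le_total (u s) 0 with h | h
    · rw [max_eq_right h]; ring
    · rw [max_eq_right (neg_nonpos.2 h)]; ring
  have hab' : ∀ s, a s * deriv b s = 0 := by
    intro s
    have h0 : HasDerivAt (fun s => -u s) (-deriv u s) s :=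
      ((hu.differentiable one_ne_zero) s).hasDerivAt.neg
    have h1 : HasDerivAt b (2 * max (-u s) 0 * -deriv u s) s :=
      HasDerivAt.comp (h₂ := fun x : ℝ => max x 0 ^ 2) s (hasDerivAt_max_zero_sq (-u s)) h0
    rw [h1.deriv]
    simp only [a]
    rcases le_total (u s) 0 with h | h
    · rw [max_eq_right h]; ring
    · rw [max_eq_right (neg_nonpos.2 h)]; ring
  refine ⟨a, b, c, ⟨ha, hb, hc⟩, ⟨fun s => by simp only [a, hup s], fun s => by simp only [b, hup s],
    fun s => by simp only [c, hup s, hvp s]⟩, hab, hab', hsq, ?_⟩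
  set g : ℝ → ℝ := fun s => c s * a s * deriv a s - deriv c s * a s ^ 2 with hg
  have hgc : Continuous g :=
    ((hc.continuous.mul ha.continuous).mul (ha.continuous_deriv le_rfl)).sub
      ((hc.continuous_deriv le_rfl).mul (ha.continuous.pow 2))
  -- Where `b` vanishes, differentiating the sphere equation gives `a a' = -c c'`, so `g = -c' (c² +
  -- a²) = -c'`. The integral over the first half period is then `c 0 - c (1/2) = 2`.
  have hpos : ∀ s, 0 < u s → g s = -deriv c s := by
    intro s hs
    have hda := ((ha.differentiable one_ne_zero) s).hasDerivAt
    have hdb := ((hb.differentiable one_ne_zero) s).hasDerivAt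
    have hdc := ((hc.differentiable one_ne_zero) s).hasDerivAt
    have h1 := ((hda.pow 2).add (hdb.pow 2)).add (hdc.pow 2)
    have h2 : HasDerivAt (a ^ 2 + b ^ 2 + c ^ 2) 0 s := by
      rw [show a ^ 2 + b ^ 2 + c ^ 2 = fun _ => 1 from funext hsq]
      exact hasDerivAt_const _ _
    have h3 := h1.unique h2
    have hb0 : b s = 0 := by
      simp only [b]
      rw [max_eq_right (by linarith)]; ring
    have h4 := hsq s
    rw [hb0] at h3 h4
    norm_num at h3
    simp only [hg]
    linear_combination (c s / 2) * h3 - deriv c s * h4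
  have hneg : ∀ s, u s < 0 → g s = 0 := by
    intro s hs
    have ha0 : a s = 0 := by
      simp only [a]
      rw [max_eq_right hs.le]; ring
    simp only [hg, ha0]
    ring
  have hi := fun x y : ℝ => hgc.intervalIntegrable (μ := volume) x y
  rw [← intervalIntegral.integral_add_adjacent_intervals (hi 0 (1 / 2)) (hi (1 / 2) 1),
    intervalIntegral.integral_eq_sub_of_hasDerivAt_of_le (f := fun s => -c s) (by norm_num)
      hc.continuous.neg.continuousOn (fun s hs => ?_) (hi _ _),
    intervalIntegral.integral_eq_sub_of_hasDerivAt_of_le (f := fun _ => 0) (by norm_num)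
      continuousOn_const (fun s hs => ?_) (hi _ _)]
  · have e1 : 2 * Real.pi * (1 / 2) = Real.pi := by ring
    simp only [c, u, v, e1]
    norm_num
  · rw [hneg]
    · exact hasDerivAt_const _ _
    · have := Real.sin_neg_of_neg_of_neg_pi_lt (x := 2 * Real.pi * s - 2 * Real.pi)
        (by nlinarith [Real.pi_pos, hs.2]) (by nlinarith [Real.pi_pos, hs.1])
      rwa [Real.sin_sub_two_pi] at this
  · rw [hpos]
    · exact ((hc.differentiable one_ne_zero) s).hasDerivAt.neg
    · exact Real.sin_pos_of_pos_of_lt_pi (mul_pos Real.two_pi_pos hs.1)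
        (by nlinarith [Real.pi_pos, hs.2])

/-- The determinant of the change of coordinates is, up to sign, the inverse of the area. -/
theorem det_coordL_mul_area (X : Module.Basis (Fin 2) ℝ Plane) :
    |(coordL X 0 (EuclideanSpace.single 0 1) * coordL X 1 (EuclideanSpace.single 1 1) -
      coordL X 0 (EuclideanSpace.single 1 1) * coordL X 1 (EuclideanSpace.single 0 1))| *
        (area X).real Set.univ = 1 := by
  let b := (EuclideanSpace.basisFun (Fin 2) ℝ).toBasis
  have harea : (area X).real Set.univ = volume.real (ZSpan.fundamentalDomain X) := by
    rw [measureReal_def, measureReal_def, area, Measure.map_apply (continuous_proj X).measurable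
      MeasurableSet.univ, Set.preimage_univ, Measure.restrict_apply_univ]
  have hone : volume.real (ZSpan.fundamentalDomain b) = 1 := by
    rw [measureReal_def, measure_congr (ZSpan.fundamentalDomain_ae_parallelepiped b volume)]
    have := (EuclideanSpace.basisFun (Fin 2) ℝ).volume_parallelepiped
    simp only [b, OrthonormalBasis.coe_toBasis]
    rw [this, ENNReal.toReal_one]
  rw [harea, ZSpan.measureReal_fundamentalDomain X volume b, hone, mul_one, Module.Basis.det_apply]
  have hdet : coordL X 0 (EuclideanSpace.single 0 1) * coordL X 1 (EuclideanSpace.single 1 1) -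
      coordL X 0 (EuclideanSpace.single 1 1) * coordL X 1 (EuclideanSpace.single 0 1) =
      (X.toMatrix b).det := by
    rw [Matrix.det_fin_two]
    simp [Module.Basis.toMatrix_apply, coordL, b]
  rw [hdet, ← abs_mul, ← Matrix.det_mul, Module.Basis.toMatrix_mul_toMatrix_flip, Matrix.det_one,
    abs_one]

end Nonempty

/-! ### Maps of every degree. -/

section Degree

variable {X : Module.Basis (Fin 2) ℝ Plane}

theorem pderiv_apply (i : Fin 2) {f : Torus X → Space} (hf : ContDiff ℝ 1 fun x => f (proj X x))
    (q : Torus X) (j : Fin 3) : pderiv i f q j = pderiv i (fun q => f q j) q := by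
  obtain ⟨x, rfl⟩ := proj_surjective X q
  rw [pderiv_proj, pderiv_proj]
  have := ((EuclideanSpace.proj j : Space →L[ℝ] ℝ).hasFDerivAt.comp x
    (hf.differentiable one_ne_zero x).hasFDerivAt).fderiv
  exact (congrArg (fun L => L (EuclideanSpace.single i (1 : ℝ))) this).symm

/-- There is a sphere valued map of degree `n`, up to the orientation of the basis of periods. -/
theorem exists_degree_eq (X : Module.Basis (Fin 2) ℝ Plane) (n : ℤ) :
    ∃ φ : H1Map X, (∀ q, ‖φ.toFun q‖ = 1) ∧ degree φ = n *
      ((coordL X 0 (EuclideanSpace.single 0 1) * coordL X 1 (EuclideanSpace.single 1 1) -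
        coordL X 0 (EuclideanSpace.single 1 1) * coordL X 1 (EuclideanSpace.single 0 1)) *
        (area X).real Set.univ) := by
  obtain ⟨a, b, c, ⟨ha, hb, hc⟩, ⟨hpa, hpb, hpc⟩, hab, hab', hsq, hint⟩ := exists_profile
  set S := coordL X 0 with hS
  set T := coordL X 1 with hT
  let κ : ℝ := 2 * Real.pi * n
  have hcos : Function.Periodic (fun t => Real.cos (κ * t)) 1 := fun t => by
    have : κ * (t + 1) = κ * t + n * (2 * Real.pi) := by simp only [κ]; ring
    simp only [this, Real.cos_add_int_mul_two_pi]
  have hsin : Function.Periodic (fun t => Real.sin (κ * t)) 1 := fun t => by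
    have : κ * (t + 1) = κ * t + n * (2 * Real.pi) := by simp only [κ]; ring
    simp only [this, Real.sin_add_int_mul_two_pi]
  -- The outgoing arc `a` turns `n` times about the axis as the coordinate `T` runs through a
  -- period, while the returning arc `b` stays in a fixed half plane. Since `a b = 0`, the values
  -- remain on the sphere.
  let F : Plane → Space := fun x =>
    !₂[a (S x) * Real.cos (κ * T x) + b (S x), a (S x) * Real.sin (κ * T x), c (S x)]
  have hF : ∀ x, ∀ y ∈ periodLattice X, F (x + y) = F x := by
    intro x y hy
    have h1 := periodic_coordL hcos 1 x hy
    have h2 := periodic_coordL hsin 1 x hy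
    simp only [← hT] at h1 h2
    simp only [F, hS, periodic_coordL hpa 0 x hy, periodic_coordL hpb 0 x hy,
      periodic_coordL hpc 0 x hy, h1, h2]
  let f : Torus X → Space := descend hF
  have hfF : ∀ x, f (proj X x) = F x := fun x => rfl
  have hf : ContDiff ℝ 1 fun x => f (proj X x) := by
    refine contDiff_euclidean.2 fun j => ?_
    have hSa : ContDiff ℝ 1 fun x => a (S x) := ha.comp S.contDiff
    have hSb : ContDiff ℝ 1 fun x => b (S x) := hb.comp S.contDiff
    have hSc : ContDiff ℝ 1 fun x => c (S x) := hc.comp S.contDiff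
    have hTc : ContDiff ℝ 1 fun x => Real.cos (κ * T x) := (contDiff_const.mul T.contDiff).cos
    have hTs : ContDiff ℝ 1 fun x => Real.sin (κ * T x) := (contDiff_const.mul T.contDiff).sin
    fin_cases j
    · exact (hSa.mul hTc).add hSb
    · exact hSa.mul hTs
    · exact hSc
  refine ⟨H1Map.ofContDiff f hf, fun q => ?_, ?_⟩
  · obtain ⟨x, rfl⟩ := proj_surjective X q
    change ‖F x‖ = 1
    rw [EuclideanSpace.norm_eq, Real.sqrt_eq_one, Fin.sum_univ_three]
    simp only [F, Real.norm_eq_abs, sq_abs]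
    simp only [Matrix.cons_val_zero, Matrix.cons_val_one, Matrix.cons_val]
    linear_combination hsq (S x) + 2 * Real.cos (κ * T x) * hab (S x) +
      a (S x) ^ 2 * Real.sin_sq_add_cos_sq (κ * T x)
  · have hSd : ∀ {g : ℝ → ℝ}, ContDiff ℝ 1 g → ∀ x, HasFDerivAt (fun x => g (S x))
        (deriv g (S x) • S) x := fun hg x =>
      ((hg.differentiable one_ne_zero) _).hasDerivAt.comp_hasFDerivAt x S.hasFDerivAt
    have hTd : ∀ x, HasFDerivAt (fun x => κ * T x) (κ • T) x := fun x => T.hasFDerivAt.const_mul κ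
    have hd0 : ∀ i x, pderiv i f (proj X x) 0 =
        (deriv a (S x) * Real.cos (κ * T x) + deriv b (S x)) * S (EuclideanSpace.single i 1)
          - κ * a (S x) * Real.sin (κ * T x) * T (EuclideanSpace.single i 1) := by
      intro i x
      rw [pderiv_apply i hf, pderiv_proj]
      have h : HasFDerivAt (fun y => f (proj X y) 0) _ x :=
        ((hSd ha x).mul (hTd x).cos).add (hSd hb x)
      rw [h.fderiv]
      simp
      ring
    have hd1 : ∀ i x, pderiv i f (proj X x) 1 =
        deriv a (S x) * Real.sin (κ * T x) * S (EuclideanSpace.single i 1)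
          + κ * a (S x) * Real.cos (κ * T x) * T (EuclideanSpace.single i 1) := by
      intro i x
      rw [pderiv_apply i hf, pderiv_proj]
      have h : HasFDerivAt (fun y => f (proj X y) 1) _ x := (hSd ha x).mul (hTd x).sin
      rw [h.fderiv]
      simp
      ring
    have hd2 : ∀ i x, pderiv i f (proj X x) 2 =
        deriv c (S x) * S (EuclideanSpace.single i 1) := by
      intro i x
      rw [pderiv_apply i hf, pderiv_proj]
      have h : HasFDerivAt (fun y => f (proj X y) 2) _ x := hSd hc x
      rw [h.fderiv]
      simp
    let g : ℝ → ℝ := fun s => c s * a s * deriv a s - deriv c s * a s ^ 2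
    have hgc : Continuous g :=
      ((hc.continuous.mul ha.continuous).mul (ha.continuous_deriv le_rfl)).sub
        ((hc.continuous_deriv le_rfl).mul (ha.continuous.pow 2))
    have hper' : ∀ {h : ℝ → ℝ}, Function.Periodic h 1 → Function.Periodic (deriv h) 1 :=
      fun {h} hp s => by
        rw [← deriv_comp_add_const, funext hp]
    have hgp : Function.Periodic g 1 := fun s => by
      simp only [g, hpa s, hpc s, hper' hpa s, hper' hpc s]
    let D : ℝ := S (EuclideanSpace.single 0 1) * T (EuclideanSpace.single 1 1) -
        S (EuclideanSpace.single 1 1) * T (EuclideanSpace.single 0 1)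
    let G : Torus X → ℝ := descend (X := X) (F := fun x => g (S x)) fun x y hy =>
      periodic_coordL hgp 0 x hy
    -- The relations `a b = 0` and `a b' = 0` remove all terms involving `b`, and with them the
    -- dependence on `T`. What is left has mean `2 κ D = 4 π n D`.
    have hG : ∀ q, inner ℝ (f q) (cross (pderiv 0 f q) (pderiv 1 f q)) = κ * D * G q := by
      intro q
      obtain ⟨x, rfl⟩ := proj_surjective X q
      have hGx : G (proj X x) = g (S x) := rfl
      rw [hGx, PiLp.inner_apply, Fin.sum_univ_three]
      simp only [cross_apply, RCLike.inner_apply, conj_trivial]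
      simp only [Fin.isValue, zero_add, show (1 + 1 : Fin 3) = 2 from rfl,
        show (1 + 2 : Fin 3) = 0 from rfl, show (2 + 1 : Fin 3) = 0 from rfl,
        show (2 + 2 : Fin 3) = 1 from rfl, hd0, hd1, hd2, hfF]
      have f0 : F x 0 = a (S x) * Real.cos (κ * T x) + b (S x) := rfl
      have f1 : F x 1 = a (S x) * Real.sin (κ * T x) := rfl
      have f2 : F x 2 = c (S x) := rfl
      rw [f0, f1, f2]
      have h1 := hab (S x)
      have h2 := hab' (S x)
      have h3 := Real.sin_sq_add_cos_sq (κ * T x)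
      simp only [g, D]
      linear_combination κ * D *
        ((c (S x) * a (S x) * deriv a (S x) - deriv c (S x) * a (S x) ^ 2) * h3
          - deriv c (S x) * Real.cos (κ * T x) * h1 + c (S x) * Real.cos (κ * T x) * h2)
    have hI := integral_coordL hgc hgp 0 (X := X) (f := G) fun x => rfl
    change 1 / (4 * Real.pi) * ∫ q, inner ℝ (f q) (cross (pderiv 0 f q) (pderiv 1 f q)) ∂(area X) = _
    simp only [hG]
    rw [integral_const_mul, hI, hint]
    simp only [κ, D]
    field_simp
    ring

/-- The determinant times the area is `1` or `-1` according to the orientation of the periods; in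
the second case the winding number is taken to be `-k`. -/
theorem degreeClass_nonempty (X : Module.Basis (Fin 2) ℝ Plane) (k : ℤ) :
    (degreeClass X k).Nonempty := by
  have h := det_coordL_mul_area X
  rw [← abs_of_pos (area_real_univ_pos X), ← abs_mul] at h
  rcases (abs_eq zero_le_one).1 h with h | h
  · obtain ⟨φ, hφ, hd⟩ := exists_degree_eq X k
    exact ⟨φ, Eventually.of_forall hφ, by rw [hd, h, mul_one]⟩
  · obtain ⟨φ, hφ, hd⟩ := exists_degree_eq X (-k)
    exact ⟨φ, Eventually.of_forall hφ, by rw [hd, h]; push_cast; ring⟩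

end Degree

end BabySkyrme

end

theorem theorem3p2 (X : Module.Basis (Fin 2) ℝ BabySkyrme.Plane)
    (V : BabySkyrme.Sphere → ℝ) (hV : BabySkyrme.HasConvexExtension V) (k : ℤ) :
    ∃ φ ∈ BabySkyrme.degreeClass X k, ∀ ψ ∈ BabySkyrme.degreeClass X k,
      BabySkyrme.energy V φ ≤ BabySkyrme.energy V ψ := by
  exact BabySkyrme.exists_isMinOn_energy hV (BabySkyrme.degreeClass_nonempty X k)
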